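/- Let $\gamma\in(2/3,2)$ and put $q^*=\tfrac12(3\gamma-2)$. On $\mathbb R^5$ with coordinates $(\Sigma_+,\Sigma_-,N_+,N_-,\Omega)$ let $q=q^*\Omega+2(\Sigma_+^2+\Sigma_-^2)$ and consider the system $$\begin{aligned}\Sigma_+'&=-(2-q)\Sigma_+-2N_-^2,\\ \Sigma_-'&=-(2-q)\Sigma_--2\sqrt3\,N_+N_-,\\ N_+'&=(q+2\Sigma_+)N_++2\sqrt3\,\Sigma_-N_-,\\ N_-'&=(q+2\Sigma_+)N_-+2\sqrt3\,\Sigma_-N_+,\\ \Omega'&=2(q-q^*)\Omega,\end{aligned}$$ where the prime is the derivative with respect to $\tau$. The Bianchi type VI$_0$ phase space is $$B_1^+(\mathrm{VI}_0)=\{\Omega+\Sigma_+^2+\Sigma_-^2+N_-^2=1,\ \Omega\ge 0,\ N_->|N_+|\}.$$ Consider the equilibria $$F=(0,0,0,0,1),\qquad P_1^+(\mathrm{VI}_0)=\Big(-\tfrac{q^*}{2},0,0,\tfrac12\sqrt{q^*(2-q^*)},1-\tfrac{q^*}{2}\Big),$$ $$P_2^+(\mathrm{II})=\Big(-\tfrac{q^*}{8},-\tfrac{\sqrt3q^*}{8},\tfrac14\sqrt{q^*(2-q^*)},\tfrac14\sqrt{q^*(2-q^*)},1-\tfrac{q^*}{8}\Big),$$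 $$P_3^-(\mathrm{II})=\Big(-\tfrac{q^*}{8},\tfrac{\sqrt3q^*}{8},-\tfrac14\sqrt{q^*(2-q^*)},\tfrac14\sqrt{q^*(2-q^*)},1-\tfrac{q^*}{8}\Big).$$ A point $x\in B_1^+(\mathrm{VI}_0)$ is called generic if $x\ne P_1^+(\mathrm{VI}_0)$ and the solution through $x$ does not converge to $F$, $P_2^+(\mathrm{II})$ or $P_3^-(\mathrm{II})$ as $\tau\to-\infty$. Let $x\in B_1^+(\mathrm{VI}_0)$ be generic. Then the system has a unique solution $\varphi^\tau(x)$, $\tau\in\mathbb R$, with $\varphi^0(x)=x$, and $q(\tau)=q(\varphi^\tau(x))$ satisfies $2-q(\tau)>0$ for all $\tau\in\mathbb R$. Moreover $2-q(\tau)\to0$ exponentially as $\tau\to-\infty$: there are constants $C>0$ and $\eta>0$, depending only on $x$ and $\gamma$, such that $2-q(\tau)\le Ce^{2\eta\tau}$ for all $\tau\in\mathbb R$. -/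

import Mathlib

open Filter Topology

namespace BianchiVI0

noncomputable section

/-- Points of the extended phase space `ℝ⁵`, with coordinates
`(Σ₊, Σ₋, N₊, N₋, Ω)` in this order. -/
abbrev State : Type := Fin 5 → ℝ

/-- The coordinate `Σ₊`. -/
def sigmaPlus (x : State) : ℝ := x 0

/-- The coordinate `Σ₋`. -/
def sigmaMinus (x : State) : ℝ := x 1

/-- The coordinate `N₊` (which is `(√3 / 2) (N₂ + N₃)`). -/
def nPlus (x : State) : ℝ := x 2

/-- The coordinate `N₋` (which is `(√3 / 2) (N₂ - N₃)`). -/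
def nMinus (x : State) : ℝ := x 3

/-- The coordinate `Ω`, the normalized energy density. -/
def omega (x : State) : ℝ := x 4

/-- The constant `q* = (3γ - 2) / 2`. -/
def qStar (γ : ℝ) : ℝ := (3 * γ - 2) / 2

/-- The deceleration parameter `q = q* Ω + 2 (Σ₊² + Σ₋²)`. -/
def q (γ : ℝ) (x : State) : ℝ :=
  qStar γ * omega x + 2 * (sigmaPlus x ^ 2 + sigmaMinus x ^ 2)

/-- The right-hand side of the Wainwright-Hsu equations with `N₁ = 0` for an orthogonal perfect
fluid with linear equation of state `p = (γ - 1) ρ`: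
* `Σ₊' = -(2 - q) Σ₊ - 2 N₋²`,
* `Σ₋' = -(2 - q) Σ₋ - 2√3 N₊ N₋`,
* `N₊' = (q + 2 Σ₊) N₊ + 2√3 Σ₋ N₋`,
* `N₋' = (q + 2 Σ₊) N₋ + 2√3 Σ₋ N₊`,
* `Ω' = 2 (q - q*) Ω`. -/
def vectorField (γ : ℝ) (x : State) : State :=
  ![-(2 - q γ x) * sigmaPlus x - 2 * nMinus x ^ 2,
    -(2 - q γ x) * sigmaMinus x - 2 * √3 * nPlus x * nMinus x,
    (q γ x + 2 * sigmaPlus x) * nPlus x + 2 * √3 * sigmaMinus x * nMinus x,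
    (q γ x + 2 * sigmaPlus x) * nMinus x + 2 * √3 * sigmaMinus x * nPlus x,
    2 * (q γ x - qStar γ) * omega x]

/-- The Bianchi type VI₀ phase space `B₁⁺(VI₀)`: the constraint
`Ω + Σ₊² + Σ₋² + N₋² = 1` together with `Ω ≥ 0` and `N₋ > |N₊|`
(that is, `N₁ = 0`, `N₂ > 0`, `N₃ < 0`). The vacuum case `Ω = 0` is included. -/
def phaseSpace : Set State :=
  {x | omega x + sigmaPlus x ^ 2 + sigmaMinus x ^ 2 + nMinus x ^ 2 = 1 ∧
    0 ≤ omega x ∧ |nPlus x| < nMinus x}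

/-- `X` is the orbit `τ ↦ φ^τ(x)` of the flow: a solution of the equations, defined for all times,
with `X 0 = x`. -/
def IsSolution (γ : ℝ) (x : State) (X : ℝ → State) : Prop :=
  X 0 = x ∧ ∀ τ : ℝ, HasDerivAt X (vectorField γ (X τ)) τ

/-- The unstable set of `p` within `B₁⁺(VI₀)`: the points of the phase space whose solution
converges to `p` as `τ → -∞`. -/
def unstableSet (γ : ℝ) (p : State) : Set State :=
  {x | x ∈ phaseSpace ∧ ∃ X : ℝ → State, IsSolution γ x X ∧ Tendsto X atBot (𝓝 p)}

/-- The equilibrium `F`. -/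
def pointF : State := ![0, 0, 0, 0, 1]

/-- The equilibrium `P₁⁺(VI₀)`. -/
def pointP1 (γ : ℝ) : State :=
  ![-(qStar γ / 2), 0, 0, √(qStar γ * (2 - qStar γ)) / 2, 1 - qStar γ / 2]

/-- The equilibrium `P₂⁺(II)`, with `N₊ = N₋`. -/
def pointP2 (γ : ℝ) : State :=
  ![-(qStar γ / 8), -(√3 * qStar γ / 8), √(qStar γ * (2 - qStar γ)) / 4,
    √(qStar γ * (2 - qStar γ)) / 4, 1 - qStar γ / 8]

/-- The equilibrium `P₃⁻(II)`, with `N₊ = -N₋`. -/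
def pointP3 (γ : ℝ) : State :=
  ![-(qStar γ / 8), √3 * qStar γ / 8, -(√(qStar γ * (2 - qStar γ)) / 4),
    √(qStar γ * (2 - qStar γ)) / 4, 1 - qStar γ / 8]

/-- A point of the phase space is generic if it is not the equilibrium `P₁⁺(VI₀)` and does not lie
in the unstable set of `P₂⁺(II)`, of `P₃⁻(II)`, or of `F`. -/
def IsGeneric (γ : ℝ) (x : State) : Prop :=
  x ∈ phaseSpace ∧ x ≠ pointP1 γ ∧ x ∉ unstableSet γ (pointP2 γ) ∧
    x ∉ unstableSet γ (pointP3 γ) ∧ x ∉ unstableSet γ pointF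

end

end BianchiVI0

/-! ### Calculus on past half-lines. -/

namespace BianchiVI0

/-! Write `v = q*/2`, `p = 1 + Σ₊`, `A = N₋ + N₊`, `B = N₋ - N₊`. The constraint gives `2 - q = 2(1
- v)Ω + 2N₋²`, so the claim is that `Ω` and `N₋²` decay exponentially in the past.

The region `2Ω < p²` is past invariant: in `(p²/Ω)'` the `N₋` terms cancel, leaving `4(1 - v)(p -
p²/Ω)`. Inside it `Ω` is at most a constant times `p² exp(4(1 - v)τ)` (`exists_O_le`). Then `log p`
shows that `N₋²` is integrable, and the orbit converges to a Kasner point `(a, b)` with `a > -1`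
(`exists_limits`). The growth rates of `A` and `B` tend to `2(1 + a ± √3 b)`. They are nonnegative
because `A` and `B` are bounded, and nonzero because no orbit converges to the Taub points `(1/2,
±√3/2)` (`rate_B_ne_zero`). Positive rates give exponential decay (`exists_exp_bound_of_trap`).

It remains to see that a generic orbit meets this region (`limits_of_not_trap`). Suppose it does
not. Coming too close to the Taub point `(-1, 0)` would force entry (`exists_trap_of_small`), so
`p`, and hence `Ω ≥ p²/2`, is bounded below in the past. If the type VI₀ monotone function stays
away from zero in the past, the orbit is `P₁⁺(VI₀)` (`eq_P1_of_le_logZ`). Otherwise `AB → 0`. Then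
either the orbit converges to `F`, or `N₋` is bounded below (`tendsto_F_or`) and one of `A`, `B`
tends to zero. In the latter case the orbit shadows a type II orbit. The type II monotone function
is perturbed by a multiple of `N₋B` (for `N₊ > 0`). Adding both monotone functions shows that this
error decays exponentially, and the orbit converges to `P₂⁺(II)` or, by reflection, to `P₃⁻(II)`
(`tendsto_P2`). All four alternatives are excluded by genericity. -/

theorem le_of_hasDerivAt_nonneg {f f' : ℝ → ℝ} {a b : ℝ} (hab : a ≤ b)
    (hf : ∀ t ∈ Set.Icc a b, HasDerivAt f (f' t) t) (h : ∀ t ∈ Set.Ioo a b, 0 ≤ f' t) :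
    f a ≤ f b := by
  have hm : MonotoneOn f (Set.Icc a b) := by
    apply monotoneOn_of_deriv_nonneg (convex_Icc a b)
    · exact fun t ht => (hf t ht).continuousAt.continuousWithinAt
    · intro t ht
      rw [interior_Icc] at ht
      exact (hf t (Set.Ioo_subset_Icc_self ht)).differentiableAt.differentiableWithinAt
    · intro t ht
      rw [interior_Icc] at ht
      rw [(hf t (Set.Ioo_subset_Icc_self ht)).deriv]
      exact h t ht
  exact hm (Set.left_mem_Icc.2 hab) (Set.right_mem_Icc.2 hab) hab

theorem mono_of_hasDerivAt {f f' : ℝ → ℝ} {c : ℝ} (hf : ∀ t ≤ c, HasDerivAt f (f' t) t)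
    (h : ∀ t ≤ c, 0 ≤ f' t) {a b : ℝ} (hab : a ≤ b) (hb : b ≤ c) : f a ≤ f b :=
  le_of_hasDerivAt_nonneg hab (fun t ht => hf t (ht.2.trans hb))
    (fun t ht => h t (ht.2.le.trans hb))

theorem exists_tendsto_atBot {F : ℝ → ℝ} {c m : ℝ}
    (hF : ∀ a b, a ≤ b → b ≤ c → F a ≤ F b) (hm : ∀ t ≤ c, m ≤ F t) :
    ∃ L, Tendsto F atBot (𝓝 L) ∧ ∀ t ≤ c, L ≤ F t := by
  have hmono : Monotone fun t => F (min t c) := fun a b hab =>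
    hF _ _ (min_le_min_right c hab) (min_le_right _ _)
  have hbd : BddBelow (Set.range fun t => F (min t c)) := by
    refine ⟨m, ?_⟩
    rintro _ ⟨t, rfl⟩
    exact hm _ (min_le_right _ _)
  refine ⟨_, (tendsto_atBot_ciInf hmono hbd).congr' ?_, fun t ht => ?_⟩
  · filter_upwards [eventually_le_atBot c] with t ht
    rw [min_eq_left ht]
  · have := ciInf_le hbd t
    simpa [min_eq_left ht] using this

/-- A nonnegative function with bounded derivative, dominated by the derivative of a function that
is bounded below, tends to zero. -/
theorem tendsto_zero_of_le_deriv {F F' g g' : ℝ → ℝ} {c m K : ℝ}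
    (hF : ∀ t ≤ c, HasDerivAt F (F' t) t) (hg : ∀ t ≤ c, HasDerivAt g (g' t) t)
    (hg0 : ∀ t ≤ c, 0 ≤ g t) (hle : ∀ t ≤ c, g t ≤ F' t) (hK : ∀ t ≤ c, |g' t| ≤ K)
    (hm : ∀ t ≤ c, m ≤ F t) : Tendsto g atBot (𝓝 0) := by
  obtain ⟨L, hL, hLF⟩ := exists_tendsto_atBot
    (fun a b hab hb => mono_of_hasDerivAt hF (fun t ht => (hg0 t ht).trans (hle t ht)) hab hb) hm
  have hK0 : 0 ≤ K := (abs_nonneg _).trans (hK c le_rfl)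
  rw [Metric.tendsto_nhds]
  intro ε hε
  set h := ε / (2 * (K + 1)) with hh
  have hhpos : 0 < h := by positivity
  have hKh : K * h ≤ ε / 2 := by
    have : (K + 1) * h = ε / 2 := by rw [hh]; field_simp
    nlinarith
  have hev : ∀ᶠ t in atBot, F t < L + ε / 2 * h := hL.eventually_lt_const (by
    have : 0 < ε / 2 * h := by positivity
    linarith)
  filter_upwards [hev, eventually_le_atBot c] with t ht htc
  rw [Real.dist_eq, sub_zero, abs_of_nonneg (hg0 t htc)]
  by_contra! hge
  -- If `g t ≥ ε`, the derivative bound keeps `g ≥ ε/2` on a window of length `h`. So `F` rises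
  -- there by at least `ε/2 * h`, too much near its limit.
  have hlow : ∀ s ∈ Set.Icc (t - h) t, ε / 2 ≤ g s := by
    intro s hs
    have h1 : K * s - g s ≤ K * t - g t := by
      refine mono_of_hasDerivAt (c := c) (f := fun x => K * x - g x) (f' := fun x => K * 1 - g' x)
        (fun x hx => ((hasDerivAt_id x).const_mul K).sub (hg x hx)) (fun x hx => ?_) hs.2 htc
      have := (abs_le.1 (hK x hx)).2
      linarith
    have h2 : K * (t - s) ≤ K * h := mul_le_mul_of_nonneg_left (by linarith [hs.1]) hK0
    linarith
  have h3 : F (t - h) - ε / 2 * (t - h) ≤ F t - ε / 2 * t := by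
    refine le_of_hasDerivAt_nonneg (f := fun x => F x - ε / 2 * x)
      (f' := fun x => F' x - ε / 2 * 1) (by linarith)
      (fun x hx => (hF x (hx.2.trans htc)).sub ((hasDerivAt_id x).const_mul _)) (fun x hx => ?_)
    have h4 := hlow x ⟨hx.1.le, hx.2.le⟩
    have h5 := hle x (hx.2.le.trans htc)
    linarith
  have h6 := hLF (t - h) (by linarith)
  linarith

/-- If a function converges and its derivative is Lipschitz, then the derivative tends to zero. -/
theorem tendsto_deriv_zero {f g g' : ℝ → ℝ} {c K L : ℝ}
    (hf : ∀ t ≤ c, HasDerivAt f (g t) t) (hg : ∀ t ≤ c, HasDerivAt g (g' t) t)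
    (hK : ∀ t ≤ c, |g' t| ≤ K) (hL : Tendsto f atBot (𝓝 L)) : Tendsto g atBot (𝓝 0) := by
  have hK0 : 0 ≤ K := (abs_nonneg _).trans (hK c le_rfl)
  rw [Metric.tendsto_nhds]
  intro ε hε
  set h := ε / (2 * (K + 1)) with hh
  have hhpos : 0 < h := by positivity
  have hKh : K * h ≤ ε / 2 := by
    have : (K + 1) * h = ε / 2 := by rw [hh]; field_simp
    nlinarith
  have hd : Tendsto (fun t => f t - f (t - h)) atBot (𝓝 (L - L)) :=
    hL.sub (hL.comp (tendsto_atBot_add_const_right _ (-h) tendsto_id))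
  rw [sub_self] at hd
  have hev : ∀ᶠ t in atBot, |f t - f (t - h)| < ε / 2 * h := by
    have := (Metric.tendsto_nhds.1 hd) (ε / 2 * h) (by positivity)
    simpa [Real.dist_eq] using this
  filter_upwards [hev, eventually_le_atBot c] with t ht htc
  rw [Real.dist_eq, sub_zero]
  have hclose : ∀ s ∈ Set.Icc (t - h) t, g t - ε / 2 ≤ g s ∧ g s ≤ g t + ε / 2 := by
    intro s hs
    have h2 : K * (t - s) ≤ K * h := mul_le_mul_of_nonneg_left (by linarith [hs.1]) hK0
    have h1 : K * s - g s ≤ K * t - g t := by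
      refine mono_of_hasDerivAt (c := c) (f := fun x => K * x - g x) (f' := fun x => K * 1 - g' x)
        (fun x hx => ((hasDerivAt_id x).const_mul K).sub (hg x hx)) (fun x hx => ?_) hs.2 htc
      have := (abs_le.1 (hK x hx)).2
      linarith
    have h3 : K * s + g s ≤ K * t + g t := by
      refine mono_of_hasDerivAt (c := c) (f := fun x => K * x + g x) (f' := fun x => K * 1 + g' x)
        (fun x hx => ((hasDerivAt_id x).const_mul K).add (hg x hx)) (fun x hx => ?_) hs.2 htc
      have := (abs_le.1 (hK x hx)).1
      linarith
    constructor <;> linarith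
  have h3 : f (t - h) - (g t - ε / 2) * (t - h) ≤ f t - (g t - ε / 2) * t := by
    refine le_of_hasDerivAt_nonneg (f := fun x => f x - (g t - ε / 2) * x)
      (f' := fun x => g x - (g t - ε / 2) * 1) (by linarith)
      (fun x hx => (hf x (hx.2.trans htc)).sub ((hasDerivAt_id x).const_mul _)) (fun x hx => ?_)
    have h4 := (hclose x ⟨hx.1.le, hx.2.le⟩).1
    linarith
  have h4 : (g t + ε / 2) * (t - h) - f (t - h) ≤ (g t + ε / 2) * t - f t := by
    refine le_of_hasDerivAt_nonneg (f := fun x => (g t + ε / 2) * x - f x)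
      (f' := fun x => (g t + ε / 2) * 1 - g x) (by linarith)
      (fun x hx => ((hasDerivAt_id x).const_mul _).sub (hf x (hx.2.trans htc))) (fun x hx => ?_)
    have h4 := (hclose x ⟨hx.1.le, hx.2.le⟩).2
    linarith
  have h5 := abs_lt.1 ht
  rw [abs_lt]
  constructor
  · by_contra! hcon
    nlinarith
  · by_contra! hcon
    nlinarith

/-- A bounded function whose derivative is dominated by that of a function bounded below
converges. -/
theorem exists_tendsto_of_abs_deriv_le {f f' F F' : ℝ → ℝ} {c m M : ℝ}
    (hf : ∀ t ≤ c, HasDerivAt f (f' t) t) (hF : ∀ t ≤ c, HasDerivAt F (F' t) t)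
    (hle : ∀ t ≤ c, |f' t| ≤ F' t) (hm : ∀ t ≤ c, m ≤ F t) (hM : ∀ t ≤ c, M ≤ f t) :
    ∃ L, Tendsto f atBot (𝓝 L) := by
  obtain ⟨L1, h1, -⟩ := exists_tendsto_atBot (F := F) (c := c)
    (fun a b hab hb => mono_of_hasDerivAt hF
      (fun t ht => (abs_nonneg _).trans (hle t ht)) hab hb) hm
  -- Both `F` and `F + f` are monotone and bounded below, and `f` is their difference.
  obtain ⟨L2, h2, -⟩ := exists_tendsto_atBot (F := fun t => F t + f t) (c := c) (m := m + M)
    (fun a b hab hb => mono_of_hasDerivAt (f := fun t => F t + f t)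
      (fun t ht => (hF t ht).add (hf t ht))
      (fun t ht => by have := (abs_le.1 (hle t ht)).1; linarith) hab hb)
    (fun t ht => add_le_add (hm t ht) (hM t ht))
  exact ⟨L2 - L1, by simpa using h2.sub h1⟩

theorem eq_mul_exp_integral {f a : ℝ → ℝ} (hf : ∀ t, HasDerivAt f (a t * f t) t)
    (ha : Continuous a) (t : ℝ) : f t = f 0 * Real.exp (∫ s in (0 : ℝ)..t, a s) := by
  have hI : ∀ t, HasDerivAt (fun t => ∫ s in (0 : ℝ)..t, a s) (a t) t := fun t =>
    (ha.integral_hasStrictDerivAt 0 t).hasDerivAt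
  have hd : ∀ t, HasDerivAt (fun t => f t * Real.exp (-∫ s in (0 : ℝ)..t, a s)) 0 t := by
    intro t
    refine ((hf t).mul (hI t).neg.exp).congr_deriv ?_
    ring
  have hc := is_const_of_deriv_eq_zero (fun t => (hd t).differentiableAt)
    (fun t => (hd t).deriv) t 0
  simp only [intervalIntegral.integral_same, neg_zero, Real.exp_zero, mul_one] at hc
  rw [← hc, mul_assoc, ← Real.exp_add]
  simp

theorem le_exp_of_hasDerivAt {f a : ℝ → ℝ} {c l : ℝ} (hf : ∀ t ≤ c, HasDerivAt f (a t * f t) t)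
    (h0 : ∀ t ≤ c, 0 ≤ f t) (ha : ∀ t ≤ c, l ≤ a t) {t : ℝ} (ht : t ≤ c) :
    f t ≤ f c * Real.exp (l * (t - c)) := by
  have h : f t * Real.exp (-(l * t)) ≤ f c * Real.exp (-(l * c)) := by
    refine mono_of_hasDerivAt (f := fun x => f x * Real.exp (-(l * x)))
      (fun x hx => (hf x hx).mul (((hasDerivAt_id x).const_mul l).neg.exp)) (fun x hx => ?_) ht
      le_rfl
    have := mul_nonneg (mul_nonneg (sub_nonneg.2 (ha x hx)) (h0 x hx)) (Real.exp_nonneg (-(l * x)))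
    simp only [id, Pi.neg_apply]
    linarith
  calc f t = f t * Real.exp (-(l * t)) * Real.exp (l * t) := by
        rw [mul_assoc, ← Real.exp_add]; simp
    _ ≤ f c * Real.exp (-(l * c)) * Real.exp (l * t) :=
        mul_le_mul_of_nonneg_right h (Real.exp_nonneg _)
    _ = f c * Real.exp (l * (t - c)) := by
        rw [mul_assoc, ← Real.exp_add]; congr 2; ring

theorem exp_le_of_hasDerivAt {f a : ℝ → ℝ} {c l : ℝ} (hf : ∀ t ≤ c, HasDerivAt f (a t * f t) t)
    (h0 : ∀ t ≤ c, 0 ≤ f t) (ha : ∀ t ≤ c, a t ≤ l) {t : ℝ} (ht : t ≤ c) :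
    f c * Real.exp (l * (t - c)) ≤ f t := by
  have h : -(f t * Real.exp (-(l * t))) ≤ -(f c * Real.exp (-(l * c))) := by
    refine mono_of_hasDerivAt (f := fun x => -(f x * Real.exp (-(l * x))))
      (fun x hx => ((hf x hx).mul (((hasDerivAt_id x).const_mul l).neg.exp)).neg)
      (fun x hx => ?_) ht le_rfl
    have := mul_nonneg (mul_nonneg (sub_nonneg.2 (ha x hx)) (h0 x hx)) (Real.exp_nonneg (-(l * x)))
    simp only [id, Pi.neg_apply]
    linarith
  calc f c * Real.exp (l * (t - c)) = f c * Real.exp (-(l * c)) * Real.exp (l * t) := by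
        rw [mul_assoc, ← Real.exp_add]; congr 2; ring
    _ ≤ f t * Real.exp (-(l * t)) * Real.exp (l * t) :=
        mul_le_mul_of_nonneg_right (by linarith) (Real.exp_nonneg _)
    _ = f t := by rw [mul_assoc, ← Real.exp_add]; simp

theorem exp_mul_sub (l t c : ℝ) :
    Real.exp (l * (t - c)) = Real.exp (-(l * c)) * Real.exp (l * t) := by
  rw [← Real.exp_add]; congr 1; ring

theorem tendsto_exp_mul_atBot {l : ℝ} (hl : 0 < l) :
    Tendsto (fun t => Real.exp (l * t)) atBot (𝓝 0) :=
  Real.tendsto_exp_atBot.comp (tendsto_id.const_mul_atBot hl)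

/-- Solutions of a scalar linear equation whose rate converges to a positive number decay
exponentially in the past. -/
theorem exists_le_exp_of_rate {f a : ℝ → ℝ} {μ l : ℝ} (hf : ∀ t, HasDerivAt f (a t * f t) t)
    (h0 : ∀ t, 0 ≤ f t) (ha : Tendsto a atBot (𝓝 μ)) (hl : l < μ) :
    ∃ C c, 0 < C ∧ ∀ t ≤ c, f t ≤ C * Real.exp (l * t) := by
  obtain ⟨c, hc⟩ := eventually_atBot.1 (ha.eventually_const_le hl)
  refine ⟨(f c + 1) * Real.exp (-(l * c)), c, ?_, fun t ht => ?_⟩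
  · have := h0 c
    positivity
  · refine (le_exp_of_hasDerivAt (fun s _ => hf s) (fun s _ => h0 s) hc ht).trans ?_
    rw [exp_mul_sub, ← mul_assoc]
    gcongr
    linarith

theorem tendsto_zero_of_rate {f a : ℝ → ℝ} {μ : ℝ} (hf : ∀ t, HasDerivAt f (a t * f t) t)
    (h0 : ∀ t, 0 ≤ f t) (ha : Tendsto a atBot (𝓝 μ)) (hμ : 0 < μ) : Tendsto f atBot (𝓝 0) := by
  obtain ⟨C, c, -, h⟩ := exists_le_exp_of_rate hf h0 ha (half_lt_self hμ)
  refine tendsto_of_tendsto_of_tendsto_of_le_of_le' (h := fun t => C * Real.exp (μ / 2 * t))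
    tendsto_const_nhds ?_ (Eventually.of_forall h0)
    (eventually_atBot.2 ⟨c, h⟩)
  simpa using (tendsto_exp_mul_atBot (half_pos hμ)).const_mul C

/-- A negative limiting rate would make `f` blow up exponentially in the past. -/
theorem rate_nonneg {f a : ℝ → ℝ} {μ M : ℝ} (hf : ∀ t, HasDerivAt f (a t * f t) t)
    (h0 : ∀ t, 0 < f t) (hM : ∀ t, f t ≤ M) (ha : Tendsto a atBot (𝓝 μ)) : 0 ≤ μ := by
  by_contra! hμ
  obtain ⟨c, hc⟩ := eventually_atBot.1 (ha.eventually_le_const (show μ < μ / 2 by linarith))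
  have hlim : Tendsto (fun t => Real.exp (μ / 2 * t)) atBot atTop :=
    Real.tendsto_exp_atTop.comp (tendsto_id.const_mul_atBot_of_neg (by linarith))
  have hpos : 0 < f c * Real.exp (-(μ / 2 * c)) := mul_pos (h0 c) (Real.exp_pos _)
  obtain ⟨t, ht, htc⟩ := ((hlim.eventually_gt_atTop (M / (f c * Real.exp (-(μ / 2 * c))))).and
    (eventually_le_atBot c)).exists
  have h1 := exp_le_of_hasDerivAt (fun s _ => hf s) (fun s _ => (h0 s).le) hc htc
  rw [exp_mul_sub, ← mul_assoc] at h1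
  rw [div_lt_iff₀ hpos, mul_comm] at ht
  linarith [hM t]

/-- A sublevel set on which the derivative is nonnegative is invariant in the past. -/
theorem le_of_deriv_nonneg_below {f f' : ℝ → ℝ} {a c e : ℝ} (hac : a ≤ c)
    (hf : ∀ t ∈ Set.Icc a c, HasDerivAt f (f' t) t)
    (h : ∀ t ∈ Set.Icc a c, f t < e → 0 ≤ f' t) (hc : f c < e) : f a ≤ f c := by
  by_contra! hlt
  obtain ⟨d, hd1, hd2⟩ := exists_between (lt_min hc hlt)
  have hcont : ContinuousOn f (Set.Icc a c) := fun t ht => (hf t ht).continuousAt.continuousWithinAt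
  -- Look at the last time `σ` with `f ≥ d`, for a level `d` strictly between `f c` and `min e (f
  -- a)`. After `σ` the values lie below `e`, so `f` is monotone there and `d ≤ f σ ≤ f c`.
  set S := Set.Icc a c ∩ f ⁻¹' Set.Ici d with hS
  have hclosed : IsClosed S := hcont.preimage_isClosed_of_isClosed isClosed_Icc isClosed_Ici
  have hcomp : IsCompact S := isCompact_Icc.of_isClosed_subset hclosed Set.inter_subset_left
  have hne : S.Nonempty := ⟨a, Set.left_mem_Icc.2 hac, (hd2.le.trans (min_le_right _ _))⟩
  have hmem := hcomp.sSup_mem hne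
  set σ := sSup S
  have hσd : d ≤ f σ := hmem.2
  have habove : ∀ t ∈ Set.Ioo σ c, f t < d := by
    intro t ht
    by_contra! hdt
    have : t ≤ σ := le_csSup hcomp.bddAbove ⟨⟨hmem.1.1.trans ht.1.le, ht.2.le⟩, hdt⟩
    linarith [ht.1]
  have hle : f σ ≤ f c := by
    refine le_of_hasDerivAt_nonneg hmem.1.2 (fun t ht => hf t ⟨hmem.1.1.trans ht.1, ht.2⟩)
      (fun t ht => h t ⟨hmem.1.1.trans ht.1.le, ht.2.le⟩ ?_)
    exact (habove t ht).trans (hd2.trans_le (min_le_left _ _))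
  linarith

/-! ### Global existence, uniqueness and invariance of the phase space. -/

/-- A bounded Lipschitz vector field has global solutions. -/
theorem exists_global_solution {E : Type*} [NormedAddCommGroup E] [NormedSpace ℝ E]
    [CompleteSpace E] {f : E → E} {K L : NNReal} (hK : LipschitzWith K f) (hL : ∀ x, ‖f x‖ ≤ L)
    (x : E) : ∃ X : ℝ → E, X 0 = x ∧ ∀ t, HasDerivAt X (f (X t)) t := by
  have hloc : ∀ a : NNReal, ∃ X : ℝ → E, X 0 = x ∧
      ∀ t ∈ Set.Ioo (-(a : ℝ)) a, HasDerivAt X (f (X t)) t := by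
    intro a
    have h0 : (0 : ℝ) ∈ Set.Icc (-(a : ℝ)) a := ⟨by simp, by simp⟩
    -- The field is globally bounded by `L`, so the ball of radius `L * a` contains the solution up
    -- to time `a`.
    have hPL : IsPicardLindelof (fun _ => f) (⟨0, h0⟩ : Set.Icc (-(a : ℝ)) a) x (L * a) 0 L K :=
      { lipschitzOnWith := fun _ _ => hK.lipschitzOnWith
        continuousOn := fun _ _ => continuousOn_const
        norm_le := fun _ _ y _ => hL y
        mul_max_le := by simp }
    obtain ⟨X, hX0, hX⟩ := hPL.exists_eq_forall_mem_Icc_hasDerivWithinAt₀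
    exact ⟨X, hX0, fun t ht =>
      (hX t (Set.Ioo_subset_Icc_self ht)).hasDerivAt (Icc_mem_nhds ht.1 ht.2)⟩
  choose Y hY0 hY using hloc
  have hagree : ∀ a b : NNReal, 0 < a → a ≤ b → Set.EqOn (Y a) (Y b) (Set.Ioo (-(a : ℝ)) a) := by
    intro a b ha hab
    have hab' : (a : ℝ) ≤ b := by exact_mod_cast hab
    have ha' : (0 : ℝ) < a := by exact_mod_cast ha
    exact ODE_solution_unique_of_mem_Ioo (v := fun _ => f) (s := fun _ => Set.univ) (K := K)
      (fun _ _ => hK.lipschitzOnWith) (t₀ := 0) ⟨by linarith, by linarith⟩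
      (fun t ht => ⟨hY a t ht, Set.mem_univ _⟩)
      (fun t ht => ⟨hY b t ⟨by linarith [ht.1], by linarith [ht.2]⟩, Set.mem_univ _⟩)
      (by rw [hY0, hY0])
  refine ⟨fun t => Y (‖t‖₊ + 1) t, by simp [hY0], fun t => ?_⟩
  have hmem : ∀ s : ℝ, s ∈ Set.Ioo (-((‖s‖₊ + 1 : NNReal) : ℝ)) ((‖s‖₊ + 1 : NNReal) : ℝ) := by
    intro s
    have h1 : |s| < |s| + 1 := lt_add_one _
    simpa using abs_lt.1 h1
  have hd := hY (‖t‖₊ + 1) t (hmem t)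
  refine hd.congr_of_eventuallyEq ?_
  filter_upwards [Ioo_mem_nhds (hmem t).1 (hmem t).2] with s hs
  rcases le_total (‖s‖₊ + 1) (‖t‖₊ + 1) with h | h
  · exact hagree _ _ (by positivity) h (hmem s)
  · exact (hagree _ _ (by positivity) h hs).symm

theorem contDiff_vectorField (γ : ℝ) : ContDiff ℝ 1 (vectorField γ) := by
  rw [contDiff_pi]
  intro i
  fin_cases i <;> simp [vectorField, q, sigmaPlus, sigmaMinus, nPlus, nMinus, omega] <;> fun_prop

/-- The phase space is invariant under the equations, also after multiplication of the vector field
by a time-dependent scalar. -/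
theorem mem_phaseSpace_of_hasDerivAt {γ : ℝ} {X : ℝ → State} {χ : ℝ → ℝ} (hχ : Continuous χ)
    (hX : ∀ t, HasDerivAt X (χ t • vectorField γ (X t)) t) (h0 : X 0 ∈ phaseSpace) (t : ℝ) :
    X t ∈ phaseSpace := by
  have hc : Continuous X := continuous_iff_continuousAt.2 fun t => (hX t).continuousAt
  have hci : ∀ i, Continuous fun t => X t i := fun i => (continuous_apply i).comp hc
  have hd : ∀ i t, HasDerivAt (fun t => X t i) (χ t * vectorField γ (X t) i) t := fun i t =>
    (hasDerivAt_pi.1 (hX t)) i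
  have h0' := hci 0
  have h1' := hci 1
  have h2' := hci 2
  have h3' := hci 3
  have h4' := hci 4
  have d0 := hd 0
  have d1 := hd 1
  have d2 := hd 2
  have d3 := hd 3
  have d4 := hd 4
  simp only [vectorField, q, sigmaPlus, sigmaMinus, nPlus, nMinus, omega, Matrix.cons_val] at *
  obtain ⟨e1, e2, e3⟩ := h0
  rw [abs_lt] at e3
  simp only [sigmaPlus, sigmaMinus, nPlus, nMinus, omega] at e1 e2 e3
  have s3 : √3 ^ 2 = (3 : ℝ) := Real.sq_sqrt (by norm_num)
  -- `N₋ ± N₊`, `Ω` and the defect of the constraint each solve a scalar linear equation, so their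
  -- signs, respectively their vanishing, persist.
  have hA := eq_mul_exp_integral (f := fun t => X t 3 + X t 2)
    (a := fun t => χ t * (qStar γ * X t 4 + 2 * (X t 0 ^ 2 + X t 1 ^ 2) + 2 * X t 0
      + 2 * √3 * X t 1)) (fun t => ((d3 t).add (d2 t)).congr_deriv (by ring)) (by fun_prop) t
  have hB := eq_mul_exp_integral (f := fun t => X t 3 - X t 2)
    (a := fun t => χ t * (qStar γ * X t 4 + 2 * (X t 0 ^ 2 + X t 1 ^ 2) + 2 * X t 0
      - 2 * √3 * X t 1)) (fun t => ((d3 t).sub (d2 t)).congr_deriv (by ring)) (by fun_prop) t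
  have hO := eq_mul_exp_integral (f := fun t => X t 4)
    (a := fun t => χ t * (2 * (qStar γ * X t 4 + 2 * (X t 0 ^ 2 + X t 1 ^ 2) - qStar γ)))
    (fun t => (d4 t).congr_deriv (by ring)) (by fun_prop) t
  have hG := eq_mul_exp_integral
    (f := fun t => X t 4 + X t 0 ^ 2 + X t 1 ^ 2 + X t 3 ^ 2 - 1)
    (a := fun t => χ t * (2 * (qStar γ * X t 4 + 2 * (X t 0 ^ 2 + X t 1 ^ 2))))
    (fun t => ((((d4 t).add ((d0 t).pow 2)).add ((d1 t).pow 2)).add ((d3 t).pow 2)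
      |>.sub_const 1).congr_deriv (by push_cast; ring))
    (by fun_prop) t
  refine ⟨?_, ?_, ?_⟩
  · rw [e1] at hG
    simp only [sigmaPlus, sigmaMinus, nMinus, omega]
    linarith
  · simp only [omega]
    rw [hO]
    positivity
  · simp only [nPlus, nMinus]
    rw [abs_lt]
    have hA' : 0 < X t 3 + X t 2 := by
      rw [hA]
      exact mul_pos (by linarith) (Real.exp_pos _)
    have hB' : 0 < X t 3 - X t 2 := by
      rw [hB]
      exact mul_pos (by linarith) (Real.exp_pos _)
    constructor <;> linarith

theorem norm_le_one_of_mem_phaseSpace {x : State} (hx : x ∈ phaseSpace) : ‖x‖ ≤ 1 := by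
  obtain ⟨e1, e2, e3⟩ := hx
  simp only [sigmaPlus, sigmaMinus, nPlus, nMinus, omega] at e1 e2 e3
  have hN : |x 3| ≤ 1 := by
    rw [← sq_le_one_iff_abs_le_one]
    nlinarith [sq_nonneg (x 0), sq_nonneg (x 1)]
  rw [pi_norm_le_iff_of_nonneg zero_le_one]
  intro i
  rw [Real.norm_eq_abs]
  fin_cases i
  · change |x 0| ≤ 1
    rw [← sq_le_one_iff_abs_le_one]
    nlinarith [sq_nonneg (x 3), sq_nonneg (x 1)]
  · change |x 1| ≤ 1
    rw [← sq_le_one_iff_abs_le_one]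
    nlinarith [sq_nonneg (x 0), sq_nonneg (x 3)]
  · exact e3.le.trans ((le_abs_self _).trans hN)
  · exact hN
  · change |x 4| ≤ 1
    rw [abs_of_nonneg e2]
    nlinarith [sq_nonneg (x 0), sq_nonneg (x 1), sq_nonneg (x 3)]

theorem IsSolution.mem_phaseSpace {γ : ℝ} {x : State} {X : ℝ → State} (hX : IsSolution γ x X)
    (hx : x ∈ phaseSpace) (t : ℝ) : X t ∈ phaseSpace :=
  mem_phaseSpace_of_hasDerivAt (χ := fun _ => 1) continuous_const
    (fun t => by simpa using hX.2 t) (by rw [hX.1]; exact hx) t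

theorem exists_isSolution (γ : ℝ) {x : State} (hx : x ∈ phaseSpace) :
    ∃ X, IsSolution γ x X := by
  -- Cutting off outside a ball makes the field bounded and Lipschitz. The orbit stays in the phase
  -- space, hence in the unit ball, where the cutoff equals `1`.
  let χ : ContDiffBump (0 : State) := ⟨2, 3, by norm_num, by norm_num⟩
  have hcd : ContDiff ℝ 1 fun y => χ y • vectorField γ y :=
    (χ.contDiff (n := 1)).smul (contDiff_vectorField γ)
  have hcs : HasCompactSupport fun y => χ y • vectorField γ y := χ.hasCompactSupport.smul_right
  obtain ⟨K, hK⟩ := ContDiff.lipschitzWith_of_hasCompactSupport hcs hcd one_ne_zero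
  obtain ⟨C, hC⟩ := hcs.exists_bound_of_continuous hcd.continuous
  obtain ⟨X, hX0, hX⟩ := exists_global_solution (L := C.toNNReal) hK
    (fun y => (hC y).trans (Real.le_coe_toNNReal C)) x
  have hc : Continuous X := continuous_iff_continuousAt.2 fun t => (hX t).continuousAt
  have hmem := mem_phaseSpace_of_hasDerivAt (χ := fun t => χ (X t)) (χ.continuous.comp hc) hX
    (by rw [hX0]; exact hx)
  refine ⟨X, hX0, fun t => ?_⟩
  have h1 : χ (X t) = 1 := χ.one_of_mem_closedBall (by
    rw [mem_closedBall_zero_iff]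
    exact (norm_le_one_of_mem_phaseSpace (hmem t)).trans one_le_two)
  simpa [h1] using hX t

theorem IsSolution.unique {γ : ℝ} {x : State} {X Y : ℝ → State} (hx : x ∈ phaseSpace)
    (hX : IsSolution γ x X) (hY : IsSolution γ x Y) : Y = X := by
  obtain ⟨K, hK⟩ := (contDiff_vectorField γ).contDiffOn.exists_lipschitzOnWith one_ne_zero
    (convex_closedBall (0 : State) 1) (isCompact_closedBall 0 1)
  have hb : ∀ {Z : ℝ → State}, IsSolution γ x Z → ∀ t,
      HasDerivAt Z (vectorField γ (Z t)) t ∧ Z t ∈ Metric.closedBall (0 : State) 1 :=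
    fun hZ t => ⟨hZ.2 t, mem_closedBall_zero_iff.2
      (norm_le_one_of_mem_phaseSpace (hZ.mem_phaseSpace hx t))⟩
  exact ODE_solution_unique_univ (v := fun _ => vectorField γ) (fun _ => hK) (hb hY) (hb hX)
    (t₀ := 0) (by rw [hX.1, hY.1])

/-! ### The constrained system and its elementary bounds. -/

/-- The equations on the phase space in terms of the scalar functions
`S = Σ₊`, `T = Σ₋`, `P = N₊`, `N = N₋`, `O = Ω`, with `v = q* / 2`. The constraint has been used
to write `2 - q = 2 (1 - v) Ω + 2 N₋²`. -/
structure IsOrbit (v : ℝ) (S T P N O : ℝ → ℝ) : Prop where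
  v_pos : 0 < v
  v_lt : v < 1
  dS : ∀ t, HasDerivAt S (-(2 * (1 - v) * O t + 2 * N t ^ 2) * S t - 2 * N t ^ 2) t
  dT : ∀ t, HasDerivAt T (-(2 * (1 - v) * O t + 2 * N t ^ 2) * T t - 2 * √3 * P t * N t) t
  dP : ∀ t, HasDerivAt P
    ((2 - (2 * (1 - v) * O t + 2 * N t ^ 2) + 2 * S t) * P t + 2 * √3 * T t * N t) t
  dN : ∀ t, HasDerivAt N
    ((2 - (2 * (1 - v) * O t + 2 * N t ^ 2) + 2 * S t) * N t + 2 * √3 * T t * P t) t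
  dO : ∀ t, HasDerivAt O ((4 * (1 - v) * (1 - O t) - 4 * N t ^ 2) * O t) t
  constraint : ∀ t, O t + S t ^ 2 + T t ^ 2 + N t ^ 2 = 1
  O_nonneg : ∀ t, 0 ≤ O t
  abs_lt : ∀ t, |P t| < N t

theorem two_sub_q {γ : ℝ} {x : State} (hx : x ∈ phaseSpace) :
    2 - q γ x = 2 * (1 - qStar γ / 2) * x 4 + 2 * x 3 ^ 2 := by
  obtain ⟨e1, -, -⟩ := hx
  simp only [q, sigmaPlus, sigmaMinus, nMinus, omega] at *
  linear_combination -2 * e1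

theorem IsSolution.isOrbit {γ : ℝ} (hγ : γ ∈ Set.Ioo (2 / 3 : ℝ) 2) {x : State} {X : ℝ → State}
    (hx : x ∈ phaseSpace) (hX : IsSolution γ x X) :
    IsOrbit (qStar γ / 2) (fun t => X t 0) (fun t => X t 1) (fun t => X t 2) (fun t => X t 3)
      (fun t => X t 4) := by
  have hmem := hX.mem_phaseSpace hx
  have hd : ∀ i t, HasDerivAt (fun t => X t i) (vectorField γ (X t) i) t := fun i t =>
    (hasDerivAt_pi.1 (hX.2 t)) i
  have hq : ∀ t, q γ (X t) = 2 - (2 * (1 - qStar γ / 2) * X t 4 + 2 * X t 3 ^ 2) := fun t => by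
    rw [← two_sub_q (hmem t)]; ring
  have d0 := hd 0
  have d1 := hd 1
  have d2 := hd 2
  have d3 := hd 3
  have d4 := hd 4
  simp only [vectorField, hq, sigmaPlus, sigmaMinus, nPlus, nMinus, omega, Matrix.cons_val] at *
  exact
    { v_pos := by unfold qStar; linarith [hγ.1]
      v_lt := by unfold qStar; linarith [hγ.2]
      dS := fun t => (d0 t).congr_deriv (by ring)
      dT := fun t => (d1 t).congr_deriv (by ring)
      dP := fun t => (d2 t).congr_deriv (by ring)
      dN := fun t => (d3 t).congr_deriv (by ring)
      dO := fun t => (d4 t).congr_deriv (by ring)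
      constraint := fun t => (hmem t).1
      O_nonneg := fun t => (hmem t).2.1
      abs_lt := fun t => (hmem t).2.2 }

namespace IsOrbit

variable {v : ℝ} {S T P N O : ℝ → ℝ}

/-- The reflection exchanging the roles of `N₂` and `-N₃`. -/
theorem reflect (h : IsOrbit v S T P N O) : IsOrbit v S (-T) (-P) N O where
  v_pos := h.v_pos
  v_lt := h.v_lt
  dS := h.dS
  dT := fun t => (h.dT t).neg.congr_deriv (by simp only [Pi.neg_apply]; ring)
  dP := fun t => (h.dP t).neg.congr_deriv (by simp only [Pi.neg_apply]; ring)
  dN := fun t => (h.dN t).congr_deriv (by simp only [Pi.neg_apply]; ring)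
  dO := h.dO
  constraint := fun t => by simpa using h.constraint t
  O_nonneg := h.O_nonneg
  abs_lt := fun t => by simpa using h.abs_lt t

theorem A_pos (h : IsOrbit v S T P N O) (t : ℝ) : 0 < N t + P t := by
  have := (_root_.abs_lt.1 (h.abs_lt t)).1
  linarith

theorem B_pos (h : IsOrbit v S T P N O) (t : ℝ) : 0 < N t - P t := by
  have := (_root_.abs_lt.1 (h.abs_lt t)).2
  linarith

theorem N_pos (h : IsOrbit v S T P N O) (t : ℝ) : 0 < N t := by
  linarith [h.A_pos t, h.B_pos t]

theorem dA (h : IsOrbit v S T P N O) (t : ℝ) : HasDerivAt (fun t => N t + P t)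
    ((2 - (2 * (1 - v) * O t + 2 * N t ^ 2) + 2 * S t + 2 * √3 * T t) * (N t + P t)) t :=
  ((h.dN t).add (h.dP t)).congr_deriv (by ring)

theorem dB (h : IsOrbit v S T P N O) (t : ℝ) : HasDerivAt (fun t => N t - P t)
    ((2 - (2 * (1 - v) * O t + 2 * N t ^ 2) + 2 * S t - 2 * √3 * T t) * (N t - P t)) t :=
  ((h.dN t).sub (h.dP t)).congr_deriv (by ring)

theorem N_le_one (h : IsOrbit v S T P N O) (t : ℝ) : N t ≤ 1 := by
  nlinarith [h.constraint t, h.O_nonneg t, sq_nonneg (S t), sq_nonneg (T t)]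

theorem O_le_one (h : IsOrbit v S T P N O) (t : ℝ) : O t ≤ 1 := by
  nlinarith [h.constraint t, sq_nonneg (N t), sq_nonneg (S t), sq_nonneg (T t)]

theorem abs_S_lt (h : IsOrbit v S T P N O) (t : ℝ) : |S t| < 1 := by
  rw [← sq_lt_one_iff_abs_lt_one]
  nlinarith [h.constraint t, h.O_nonneg t, pow_pos (h.N_pos t) 2, sq_nonneg (T t)]

theorem abs_T_lt (h : IsOrbit v S T P N O) (t : ℝ) : |T t| < 1 := by
  rw [← sq_lt_one_iff_abs_lt_one]
  nlinarith [h.constraint t, h.O_nonneg t, pow_pos (h.N_pos t) 2, sq_nonneg (S t)]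

theorem abs_P_le (h : IsOrbit v S T P N O) (t : ℝ) : |P t| ≤ 1 :=
  (h.abs_lt t).le.trans (h.N_le_one t)

theorem abs_N_le (h : IsOrbit v S T P N O) (t : ℝ) : |N t| ≤ 1 := by
  rw [abs_of_pos (h.N_pos t)]
  exact h.N_le_one t

theorem abs_O_le (h : IsOrbit v S T P N O) (t : ℝ) : |O t| ≤ 1 := by
  rw [abs_of_nonneg (h.O_nonneg t)]
  exact h.O_le_one t

theorem p_pos (h : IsOrbit v S T P N O) (t : ℝ) : 0 < 1 + S t := by
  linarith [(_root_.abs_lt.1 (h.abs_S_lt t)).1]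

theorem p_lt (h : IsOrbit v S T P N O) (t : ℝ) : 1 + S t < 2 := by
  linarith [(_root_.abs_lt.1 (h.abs_S_lt t)).2]

/-- `N₋² + Ω ≤ 2 (1 + Σ₊)`. -/
theorem N_sq_add_O_le (h : IsOrbit v S T P N O) (t : ℝ) : N t ^ 2 + O t ≤ 2 * (1 + S t) := by
  nlinarith [h.constraint t, sq_nonneg (T t), sq_nonneg (1 + S t)]

theorem dp (h : IsOrbit v S T P N O) (t : ℝ) : HasDerivAt (fun t => 1 + S t)
    (2 * (1 - v) * O t * (1 - (1 + S t)) - 2 * N t ^ 2 * (1 + S t)) t :=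
  ((h.dS t).const_add 1).congr_deriv (by ring)

theorem continuous_P (h : IsOrbit v S T P N O) : Continuous P :=
  continuous_iff_continuousAt.2 fun t => (h.dP t).continuousAt

theorem continuous_N (h : IsOrbit v S T P N O) : Continuous N :=
  continuous_iff_continuousAt.2 fun t => (h.dN t).continuousAt

theorem continuous_O (h : IsOrbit v S T P N O) : Continuous O :=
  continuous_iff_continuousAt.2 fun t => (h.dO t).continuousAt

theorem O_eq_mul_exp (h : IsOrbit v S T P N O) (t : ℝ) : O t = O 0 *
    Real.exp (∫ s in (0 : ℝ)..t, (4 * (1 - v) * (1 - O s) - 4 * N s ^ 2)) := by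
  have := h.continuous_O
  have := h.continuous_N
  exact eq_mul_exp_integral h.dO (by fun_prop) t

theorem exists_bound (h : IsOrbit v S T P N O) {g : ℝ × ℝ × ℝ × ℝ × ℝ → ℝ} (hg : Continuous g) :
    ∃ K, ∀ t, |g (S t, T t, P t, N t, O t)| ≤ K := by
  have hc : IsCompact (Set.Icc (-1 : ℝ) 1 ×ˢ Set.Icc (-1 : ℝ) 1 ×ˢ Set.Icc (-1 : ℝ) 1 ×ˢ
      Set.Icc (-1 : ℝ) 1 ×ˢ Set.Icc (-1 : ℝ) 1) :=
    isCompact_Icc.prod (isCompact_Icc.prod (isCompact_Icc.prod (isCompact_Icc.prod isCompact_Icc)))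
  obtain ⟨K, hK⟩ := hc.exists_bound_of_continuousOn hg.continuousOn
  exact ⟨K, fun t => hK _ ⟨abs_le.1 (h.abs_S_lt t).le, abs_le.1 (h.abs_T_lt t).le,
    abs_le.1 (h.abs_P_le t), abs_le.1 (h.abs_N_le t), abs_le.1 (h.abs_O_le t)⟩⟩

theorem dN_sq (h : IsOrbit v S T P N O) (t : ℝ) : HasDerivAt (fun t => N t ^ 2)
    (2 * N t * ((2 - (2 * (1 - v) * O t + 2 * N t ^ 2) + 2 * S t) * N t
      + 2 * √3 * T t * P t)) t :=
  ((h.dN t).pow 2).congr_deriv (by push_cast; ring)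

theorem exists_bound_dN_sq (h : IsOrbit v S T P N O) : ∃ K, ∀ t,
    |2 * N t * ((2 - (2 * (1 - v) * O t + 2 * N t ^ 2) + 2 * S t) * N t
      + 2 * √3 * T t * P t)| ≤ K :=
  h.exists_bound (g := fun x => 2 * x.2.2.2.1 * ((2 - (2 * (1 - v) * x.2.2.2.2
    + 2 * x.2.2.2.1 ^ 2) + 2 * x.1) * x.2.2.2.1 + 2 * √3 * x.2.1 * x.2.2.1)) (by fun_prop)

theorem O_pos_of_O_pos (h : IsOrbit v S T P N O) {s : ℝ} (hs : 0 < O s) (t : ℝ) : 0 < O t := by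
  have h0 : 0 < O 0 := by
    refine (h.O_nonneg 0).lt_of_ne fun h0 => ?_
    rw [h.O_eq_mul_exp, ← h0, zero_mul] at hs
    exact lt_irrefl _ hs
  rw [h.O_eq_mul_exp]
  positivity

/-! ### The trapping region and convergence to Kasner points. -/

/-- The region `2 Ω < (1 + Σ₊)²` traps orbits in the past, and `Ω` decays exponentially there. -/
theorem exists_O_le (h : IsOrbit v S T P N O) {c : ℝ} (hc : O c < (1 + S c) ^ 2 / 2) :
    ∃ C, 0 < C ∧ ∀ t ≤ c, O t ≤ C * (1 + S t) ^ 2 * Real.exp (4 * (1 - v) * t) := by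
  have hw : 0 < 1 - v := by linarith [h.v_lt]
  rcases (h.O_nonneg c).eq_or_lt with h0 | h0
  · refine ⟨1, one_pos, fun t _ => ?_⟩
    have : O t = 0 := by
      by_contra hne
      exact (h.O_pos_of_O_pos ((h.O_nonneg t).lt_of_ne' hne) c).ne h0
    rw [this]
    positivity
  have hO := h.O_pos_of_O_pos h0
  set k := 4 * (1 - v) with hk
  -- With `p = 1 + S` one has `(p²/O)' = k (p - p²/O)`, so `(p²/O - 2) exp(kt)` decreases because `p
  -- < 2`.
  have hd : ∀ t, HasDerivAt (fun t => -(((1 + S t) ^ 2 / O t - 2) * Real.exp (k * t)))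
      (k * (2 - (1 + S t)) * Real.exp (k * t)) t := by
    intro t
    have hne := (hO t).ne'
    refine ((((((h.dp t).pow 2).div (h.dO t) hne).sub_const 2).mul
      ((hasDerivAt_id t).const_mul k).exp).neg).congr_deriv ?_
    simp only [id, Pi.pow_apply, Pi.div_apply, hk]
    field_simp
    ring
  set G := ((1 + S c) ^ 2 / O c - 2) * Real.exp (k * c) with hG
  have hGpos : 0 < G := by
    refine mul_pos ?_ (Real.exp_pos _)
    rw [sub_pos, lt_div_iff₀ h0]
    linarith
  refine ⟨1 / G, by positivity, fun t ht => ?_⟩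
  have h1 := mono_of_hasDerivAt (c := c) (fun t _ => hd t) (fun t _ => by
    have := h.p_lt t
    have h2 : 0 < 2 - (1 + S t) := by linarith
    positivity) ht le_rfl
  have h2 : G ≤ ((1 + S t) ^ 2 / O t) * Real.exp (k * t) := by
    have := Real.exp_pos (k * t)
    linarith
  have h3 := hO t
  have h4 : G * O t ≤ (1 + S t) ^ 2 * Real.exp (k * t) := by
    calc G * O t ≤ (1 + S t) ^ 2 / O t * Real.exp (k * t) * O t :=
          mul_le_mul_of_nonneg_right h2 h3.le
      _ = _ := by field_simp
  calc O t = G * O t / G := by field_simp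
    _ ≤ (1 + S t) ^ 2 * Real.exp (k * t) / G := by gcongr
    _ = _ := by ring

/-- Together with `abs_dT_le` this reduces convergence of `S` and `T` to integrability of `O` and
`N²` in the past. -/
theorem abs_dS_le (h : IsOrbit v S T P N O) (t : ℝ) :
    |-(2 * (1 - v) * O t + 2 * N t ^ 2) * S t - 2 * N t ^ 2| ≤ 2 * O t + 6 * N t ^ 2 := by
  have hS := abs_le.1 (h.abs_S_lt t).le
  have hO := h.O_nonneg t
  have hw : 0 ≤ 1 - v := by linarith [h.v_lt]
  have hD : 0 ≤ 2 * (1 - v) * O t + 2 * N t ^ 2 := by positivity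
  have hD' : 2 * (1 - v) * O t ≤ 2 * O t := by nlinarith [h.v_pos]
  rw [abs_le]
  constructor <;> nlinarith [sq_nonneg (N t)]

theorem abs_dT_le (h : IsOrbit v S T P N O) (t : ℝ) :
    |-(2 * (1 - v) * O t + 2 * N t ^ 2) * T t - 2 * √3 * P t * N t| ≤ 2 * O t + 6 * N t ^ 2 := by
  have hT := abs_le.1 (h.abs_T_lt t).le
  have hO := h.O_nonneg t
  have hw : 0 ≤ 1 - v := by linarith [h.v_lt]
  have hD : 0 ≤ 2 * (1 - v) * O t + 2 * N t ^ 2 := by positivity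
  have hD' : 2 * (1 - v) * O t ≤ 2 * O t := by nlinarith [h.v_pos]
  have h3 : √3 ≤ 2 := by rw [Real.sqrt_le_left (by norm_num)]; norm_num
  have hN := h.N_pos t
  have hPN : |2 * √3 * P t * N t| ≤ 4 * N t ^ 2 := by
    rw [abs_mul, abs_mul, abs_of_pos hN, abs_of_nonneg (by positivity : 0 ≤ 2 * √3)]
    calc 2 * √3 * |P t| * N t ≤ 2 * 2 * N t * N t := by
          gcongr
          exact (h.abs_lt t).le
      _ = 4 * N t ^ 2 := by ring
  have hPN' := abs_le.1 hPN
  rw [abs_le]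
  constructor <;> nlinarith

/-- An orbit that enters the trapping region converges in the past to a Kasner point. -/
theorem exists_limits (h : IsOrbit v S T P N O) {c : ℝ} (hc : O c < (1 + S c) ^ 2 / 2) :
    ∃ a b C, -1 < a ∧ a ^ 2 + b ^ 2 = 1 ∧ 0 < C ∧
      (∀ t ≤ c, O t ≤ C * Real.exp (4 * (1 - v) * t)) ∧ Tendsto S atBot (𝓝 a) ∧
      Tendsto T atBot (𝓝 b) ∧ Tendsto N atBot (𝓝 0) ∧ Tendsto O atBot (𝓝 0) := by
  have hw : 0 < 1 - v := by linarith [h.v_lt]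
  obtain ⟨C, hC, hOC⟩ := h.exists_O_le hc
  set k := 4 * (1 - v) with hk
  have hkpos : 0 < k := by positivity
  have hO4 : ∀ t ≤ c, O t ≤ 4 * C * Real.exp (k * t) := by
    intro t ht
    refine (hOC t ht).trans ?_
    have h1 : (1 + S t) ^ 2 ≤ 4 := by nlinarith [h.p_pos t, h.p_lt t]
    have h2 := Real.exp_pos (k * t)
    calc C * (1 + S t) ^ 2 * Real.exp (k * t) ≤ C * 4 * Real.exp (k * t) := by gcongr
      _ = _ := by ring
  have hexp : ∀ t, HasDerivAt (fun t => Real.exp (k * t)) (k * Real.exp (k * t)) t := fun t =>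
    (((hasDerivAt_id t).const_mul k).exp).congr_deriv (by simp only [id]; ring)
  have hlogp : ∀ t, HasDerivAt (fun t => Real.log (1 + S t))
      ((2 * (1 - v) * O t * (1 - (1 + S t)) - 2 * N t ^ 2 * (1 + S t)) / (1 + S t)) t := fun t =>
    (h.dp t).log (h.p_pos t).ne'
  -- The logarithmic derivative of `1 + S` is `-2N²` plus a term of size at most `4C exp(kt)`. The
  -- exponential absorbs that term, so `F' ≥ 2N²`, while `1 + S < 2` bounds `F` below.
  set F : ℝ → ℝ := fun t => 4 * C / k * Real.exp (k * t) - Real.log (1 + S t) with hF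
  set F' : ℝ → ℝ := fun t => 4 * C / k * (k * Real.exp (k * t)) -
    (2 * (1 - v) * O t * (1 - (1 + S t)) - 2 * N t ^ 2 * (1 + S t)) / (1 + S t) with hF'
  have hFd : ∀ t, HasDerivAt F (F' t) t := fun t => ((hexp t).const_mul _).sub (hlogp t)
  have hFN : ∀ t ≤ c, 2 * N t ^ 2 ≤ F' t := by
    intro t ht
    have hp := h.p_pos t
    have hp2 := h.p_lt t
    have h1 : (2 * (1 - v) * O t * (1 - (1 + S t)) - 2 * N t ^ 2 * (1 + S t)) / (1 + S t)
        = 2 * (1 - v) * (O t / (1 + S t)) * (-S t) - 2 * N t ^ 2 := by field_simp; ring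
    have h2 : 4 * C / k * (k * Real.exp (k * t)) = 4 * C * Real.exp (k * t) := by field_simp
    have h3 : O t / (1 + S t) ≤ 2 * C * Real.exp (k * t) := by
      rw [div_le_iff₀ hp]
      refine (hOC t ht).trans ?_
      have h4 : 0 < C * Real.exp (k * t) * (1 + S t) := by positivity
      nlinarith
    have h5 : 0 ≤ O t / (1 + S t) := div_nonneg (h.O_nonneg t) hp.le
    have hS := abs_le.1 (h.abs_S_lt t).le
    have h6 : 2 * (1 - v) * (O t / (1 + S t)) * (-S t) ≤ 2 * 1 * (O t / (1 + S t)) * 1 := by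
      have h7 : 0 ≤ 2 * (1 - v) * (O t / (1 + S t)) := by positivity
      calc _ ≤ 2 * (1 - v) * (O t / (1 + S t)) * 1 :=
            mul_le_mul_of_nonneg_left (by linarith) h7
        _ ≤ _ := by
            gcongr
            linarith [h.v_pos]
    simp only [hF', h1, h2]
    linarith
  have hF0 : ∀ t ≤ c, 0 ≤ F' t := fun t ht => (by positivity : (0 : ℝ) ≤ 2 * N t ^ 2).trans (hFN t ht)
  have hFm : ∀ t, -Real.log 2 ≤ F t := by
    intro t
    have h1 := Real.log_le_log (h.p_pos t) (h.p_lt t).le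
    have h2 : 0 < 4 * C / k * Real.exp (k * t) := by positivity
    simp only [hF]
    linarith
  obtain ⟨K, hK⟩ := h.exists_bound_dN_sq
  have hN2 : Tendsto (fun t => N t ^ 2) atBot (𝓝 0) := by
    refine tendsto_zero_of_le_deriv (c := c) (m := -Real.log 2) (fun t _ => hFd t)
      (fun t _ => h.dN_sq t) (fun t _ => sq_nonneg _) (fun t ht => ?_) (fun t _ => hK t)
      (fun t _ => hFm t)
    linarith [hFN t ht, sq_nonneg (N t)]
  have hN : Tendsto N atBot (𝓝 0) := by
    have := hN2.sqrt
    simp only [Real.sqrt_zero] at this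
    exact this.congr fun t => Real.sqrt_sq (h.N_pos t).le
  have hO : Tendsto O atBot (𝓝 0) := by
    refine tendsto_of_tendsto_of_tendsto_of_le_of_le' (h := fun t => 4 * C * Real.exp (k * t))
      tendsto_const_nhds ?_ (Eventually.of_forall h.O_nonneg) (eventually_atBot.2 ⟨c, hO4⟩)
    simpa using (tendsto_exp_mul_atBot hkpos).const_mul (4 * C)
  have hdom : ∀ t ≤ c, 2 * O t + 6 * N t ^ 2 ≤ 3 * F' t + 8 * C / k * (k * Real.exp (k * t)) := by
    intro t ht
    have h2 : 8 * C / k * (k * Real.exp (k * t)) = 8 * C * Real.exp (k * t) := by field_simp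
    rw [h2]
    linarith [hO4 t ht, hFN t ht]
  have hGd : ∀ t, HasDerivAt (fun t => 3 * F t + 8 * C / k * Real.exp (k * t))
      (3 * F' t + 8 * C / k * (k * Real.exp (k * t))) t := fun t =>
    ((hFd t).const_mul 3).add ((hexp t).const_mul _)
  have hGm : ∀ t ≤ c, 3 * -Real.log 2 ≤ 3 * F t + 8 * C / k * Real.exp (k * t) := by
    intro t _
    have h2 : 0 < 8 * C / k * Real.exp (k * t) := by positivity
    linarith [hFm t]
  obtain ⟨a, ha⟩ := exists_tendsto_of_abs_deriv_le (fun t _ => h.dS t) (fun t _ => hGd t)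
    (fun t ht => (h.abs_dS_le t).trans (hdom t ht)) hGm
    (fun t _ => (_root_.abs_lt.1 (h.abs_S_lt t)).1.le)
  obtain ⟨b, hb⟩ := exists_tendsto_of_abs_deriv_le (fun t _ => h.dT t) (fun t _ => hGd t)
    (fun t ht => (h.abs_dT_le t).trans (hdom t ht)) hGm
    (fun t _ => (_root_.abs_lt.1 (h.abs_T_lt t)).1.le)
  refine ⟨a, b, 4 * C, ?_, ?_, by positivity, hO4, ha, hb, hN, hO⟩
  -- Monotonicity `F t ≤ F c` keeps `log (1 + S)` bounded below, which rules out the Taub point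
  -- `(-1, 0)` as a limit.
  · have hlow : ∀ t ≤ c, Real.exp (-F c) - 1 ≤ S t := by
      intro t ht
      have h1 := mono_of_hasDerivAt (fun t _ => hFd t) hF0 ht le_rfl
      have h2 : -F c ≤ Real.log (1 + S t) := by
        have h3 : 0 < 4 * C / k * Real.exp (k * t) := by positivity
        have h4 : F t = 4 * C / k * Real.exp (k * t) - Real.log (1 + S t) := rfl
        linarith
      have h5 := (Real.le_log_iff_exp_le (h.p_pos t)).1 h2
      linarith
    have := ge_of_tendsto ha (eventually_atBot.2 ⟨c, hlow⟩)
    linarith [Real.exp_pos (-F c)]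
  · have h1 : Tendsto (fun t => O t + S t ^ 2 + T t ^ 2 + N t ^ 2) atBot
        (𝓝 (0 + a ^ 2 + b ^ 2 + 0)) := ((hO.add (ha.pow 2)).add (hb.pow 2)).add hN2
    have h2 : Tendsto (fun t => O t + S t ^ 2 + T t ^ 2 + N t ^ 2) atBot (𝓝 1) :=
      tendsto_const_nhds.congr fun t => (h.constraint t).symm
    linarith [tendsto_nhds_unique h1 h2]

theorem d_ratio (h : IsOrbit v S T P N O) (t : ℝ) :
    HasDerivAt (fun t => (N t + P t) / (N t - P t))
      (4 * √3 * T t * ((N t + P t) / (N t - P t))) t := by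
  have hB := (h.B_pos t).ne'
  refine ((h.dA t).div (h.dB t) hB).congr_deriv ?_
  field_simp
  ring

/-- At the Taub point `(1/2, √3/2)` the rate of `N - P` vanishes and this rate tends to `4(1 - v) >
0`, so `O` becomes negligible against `(N - P)²`. -/
theorem d_O_div_sq (h : IsOrbit v S T P N O) (t : ℝ) :
    HasDerivAt (fun t => O t / (N t - P t) ^ 2)
      (((4 * (1 - v) * (1 - O t) - 4 * N t ^ 2) - 2 * (2 - (2 * (1 - v) * O t + 2 * N t ^ 2)
        + 2 * S t - 2 * √3 * T t)) * (O t / (N t - P t) ^ 2)) t := by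
  have hB := (h.B_pos t).ne'
  refine ((h.dO t).div ((h.dB t).pow 2) (pow_ne_zero 2 hB)).congr_deriv ?_
  simp only [Pi.pow_apply]
  push_cast
  field_simp

/-- No orbit converges in the past to a Taub point `(1/2, √3/2)`. -/
theorem rate_B_ne_zero (h : IsOrbit v S T P N O) {a b : ℝ} (ha1 : -1 < a)
    (hab : a ^ 2 + b ^ 2 = 1) (ha : Tendsto S atBot (𝓝 a)) (hb : Tendsto T atBot (𝓝 b))
    (hN : Tendsto N atBot (𝓝 0)) (hO : Tendsto O atBot (𝓝 0)) : 1 + a - √3 * b ≠ 0 := by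
  intro h0
  have hw : 0 < 1 - v := by linarith [h.v_lt]
  have s3 : √3 ^ 2 = (3 : ℝ) := Real.sq_sqrt (by norm_num)
  have hb3 : √3 * b = 1 + a := by linarith
  have ha2 : a = 1 / 2 := by
    have h1 : (1 + a) * (1 + a) = (1 + a) * (3 * (1 - a)) := by
      have : (√3 * b) ^ 2 = 3 * b ^ 2 := by rw [mul_pow, s3]
      rw [hb3] at this
      nlinarith
    have := mul_left_cancel₀ (by linarith : 1 + a ≠ 0) h1
    linarith
  have hb3' : √3 * b = 3 / 2 := by rw [hb3, ha2]; norm_num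
  have hTb : Tendsto (fun t => √3 * T t) atBot (𝓝 (√3 * b)) := hb.const_mul _
  have hrA : Tendsto (fun t => 4 * √3 * T t) atBot (𝓝 6) := by
    have := hTb.const_mul 4
    rw [hb3'] at this
    refine (this.congr fun t => by ring).trans ?_
    norm_num
  have hratio := tendsto_zero_of_rate h.d_ratio
    (fun t => (div_pos (h.A_pos t) (h.B_pos t)).le) hrA (by norm_num)
  have hrO : Tendsto (fun t => (4 * (1 - v) * (1 - O t) - 4 * N t ^ 2)
      - 2 * (2 - (2 * (1 - v) * O t + 2 * N t ^ 2) + 2 * S t - 2 * √3 * T t)) atBot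
      (𝓝 (4 * (1 - v))) := by
    have h1 : Tendsto (fun t => (4 * (1 - v) * (1 - O t) - 4 * N t ^ 2)
      - 2 * (2 - (2 * (1 - v) * O t + 2 * N t ^ 2) + 2 * S t - 2 * (√3 * T t))) atBot
      (𝓝 ((4 * (1 - v) * (1 - 0) - 4 * 0 ^ 2)
      - 2 * (2 - (2 * (1 - v) * 0 + 2 * 0 ^ 2) + 2 * a - 2 * (√3 * b)))) :=
      (((hO.const_sub 1).const_mul _).sub ((hN.pow 2).const_mul 4)).sub
        (((((hO.const_mul _).add ((hN.pow 2).const_mul 2)).const_sub 2).add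
          (ha.const_mul 2)).sub (hTb.const_mul 2) |>.const_mul 2)
    rw [hb3', ha2] at h1
    convert h1 using 2
    · ring
    · norm_num
  have hOB := tendsto_zero_of_rate h.d_O_div_sq
    (fun t => div_nonneg (h.O_nonneg t) (sq_nonneg _)) hrO (by positivity)
  have hu : Tendsto (fun t => 1 + S t - √3 * T t) atBot (𝓝 0) := by
    have := (ha.const_add 1).sub hTb
    rwa [h0] at this
  have hev : ∀ᶠ t in atBot, (N t + P t) / (N t - P t) < 1 / 10 ∧
      O t / (N t - P t) ^ 2 < 1 / 100 ∧ |1 + S t - √3 * T t| < 1 / 10 := by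
    refine (hratio.eventually_lt_const (by norm_num)).and
      ((hOB.eventually_lt_const (by norm_num)).and ?_)
    have := Metric.tendsto_nhds.1 hu (1 / 10) (by norm_num)
    simpa [Real.dist_eq] using this
  obtain ⟨c, hc⟩ := eventually_atBot.1 hev
  -- For `u = 1 + S - √3 T`, the term `-(3/2) B²` in `u'` beats all others once `A/B`, `O/B²` and
  -- `u` are small. Hence `u` decreases from its limit `0` and is nonpositive.
  have hdu : ∀ t, HasDerivAt (fun t => -(1 + S t - √3 * T t))
      (-(2 * (1 - v) * O t * (1 - (1 + S t - √3 * T t)) - 2 * N t ^ 2 * (1 + S t - √3 * T t)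
        + 3 / 2 * ((N t + P t) ^ 2 - (N t - P t) ^ 2))) t := fun t =>
    (((h.dS t).const_add 1).sub ((h.dT t).const_mul _)).neg.congr_deriv (by
      linear_combination (2 * P t * N t) * (-s3))
  have hdu0 : ∀ t ≤ c, 0 ≤ -(2 * (1 - v) * O t * (1 - (1 + S t - √3 * T t))
      - 2 * N t ^ 2 * (1 + S t - √3 * T t)
        + 3 / 2 * ((N t + P t) ^ 2 - (N t - P t) ^ 2)) := by
    intro t ht
    obtain ⟨h1, h2, h3⟩ := hc t ht
    have hA := h.A_pos t
    have hB := h.B_pos t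
    rw [div_lt_iff₀ hB] at h1
    rw [div_lt_iff₀ (by positivity)] at h2
    set A := N t + P t with hAdef
    set B := N t - P t with hBdef
    have hNAB : N t = (A + B) / 2 := by rw [hAdef, hBdef]; ring
    set u := 1 + S t - √3 * T t
    have h4 := _root_.abs_lt.1 h3
    have hN2 : N t ^ 2 ≤ B ^ 2 := by
      rw [hNAB]
      apply pow_le_pow_left₀ (by positivity)
      linarith
    have hA2 : A ^ 2 ≤ (1 / 10 * B) ^ 2 := pow_le_pow_left₀ hA.le h1.le 2
    have e1 : 2 * (1 - v) * O t * (1 - u) ≤ 2 * 1 * (1 / 100 * B ^ 2) * (11 / 10) := by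
      have := h.O_nonneg t
      gcongr
      · linarith
      · linarith [h.v_pos]
      · linarith
    have e2 : -(2 * N t ^ 2 * u) ≤ 2 * B ^ 2 * (1 / 10) := by
      have : 2 * N t ^ 2 * (-u) ≤ 2 * B ^ 2 * (1 / 10) := by
        calc 2 * N t ^ 2 * (-u) ≤ 2 * N t ^ 2 * (1 / 10) :=
              mul_le_mul_of_nonneg_left (by linarith) (by positivity)
          _ ≤ _ := by gcongr
      linarith
    have : 0 < B ^ 2 := by positivity
    nlinarith
  have hu0 : ∀ t ≤ c, 1 + S t - √3 * T t ≤ 0 := by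
    intro t ht
    have h1 : Tendsto (fun t => -(1 + S t - √3 * T t)) atBot (𝓝 0) := by simpa using hu.neg
    have := le_of_tendsto h1 (eventually_atBot.2 ⟨t, fun s hs =>
      mono_of_hasDerivAt (fun t _ => hdu t) hdu0 hs ht⟩)
    linarith
  have hNP : Tendsto (fun t => -(N t - P t)) atBot (𝓝 0) := by
    have h1 : Tendsto (fun t => 2 * N t) atBot (𝓝 0) := by simpa using hN.const_mul 2
    have h2 : Tendsto (fun t => N t - P t) atBot (𝓝 0) :=
      tendsto_of_tendsto_of_tendsto_of_le_of_le tendsto_const_nhds h1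
        (fun t => (h.B_pos t).le) (fun t => by
          simp only
          linarith [h.A_pos t])
    simpa using h2.neg
  -- The rate of `N - P` is `2u` minus a nonnegative quantity, so `N - P` is nonincreasing. Its past
  -- limit is `0`, so it cannot be positive.
  have hlim : 0 ≤ -(N c - P c) := le_of_tendsto hNP (eventually_atBot.2 ⟨c, fun s hs =>
      mono_of_hasDerivAt (fun t _ => (h.dB t).neg) (fun t ht => by
        have h1 := hu0 t ht
        have h2 := h.B_pos t
        have h3 : 0 ≤ (2 * (1 - v) * O t + 2 * N t ^ 2) := by
          have := h.O_nonneg t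
          positivity
        rw [← neg_mul]
        exact mul_nonneg (by nlinarith) h2.le) hs le_rfl⟩)
  linarith [h.B_pos c]

theorem exists_exp_bound_of_trap (h : IsOrbit v S T P N O) {c : ℝ}
    (hc : O c < (1 + S c) ^ 2 / 2) : ∃ C η c', 0 < C ∧ 0 < η ∧
      ∀ t ≤ c', 2 * (1 - v) * O t + 2 * N t ^ 2 ≤ C * Real.exp (2 * η * t) := by
  have hw : 0 < 1 - v := by linarith [h.v_lt]
  obtain ⟨a, b, C, ha1, hab, hC, hOC, ha, hb, hN, hO⟩ := h.exists_limits hc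
  have hrate : ∀ {σ : ℝ}, Tendsto (fun t => 2 - (2 * (1 - v) * O t + 2 * N t ^ 2) + 2 * S t
      + 2 * (σ * T t)) atBot (𝓝 (2 * (1 + a + σ * b))) := by
    intro σ
    have := ((((hO.const_mul (2 * (1 - v))).add ((hN.pow 2).const_mul 2)).const_sub 2).add
          (ha.const_mul 2)).add ((hb.const_mul σ).const_mul 2)
    convert this using 2
    ring
  have hrA : Tendsto (fun t => 2 - (2 * (1 - v) * O t + 2 * N t ^ 2) + 2 * S t
      + 2 * √3 * T t) atBot (𝓝 (2 * (1 + a + √3 * b))) :=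
    (hrate (σ := √3)).congr fun t => by ring
  have hrB : Tendsto (fun t => 2 - (2 * (1 - v) * O t + 2 * N t ^ 2) + 2 * S t
      - 2 * √3 * T t) atBot (𝓝 (2 * (1 + a - √3 * b))) := by
    have := (hrate (σ := -√3)).congr (f₂ := fun t => 2 - (2 * (1 - v) * O t + 2 * N t ^ 2)
      + 2 * S t - 2 * √3 * T t) fun t => by ring
    convert this using 2
    ring
  have hA0 : 0 < 1 + a + √3 * b := by
    have h1 := rate_nonneg (M := 2) h.dA h.A_pos
      (fun t => by linarith [h.N_le_one t, h.B_pos t]) hrA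
    -- The reflection carries the Taub point `(1/2, -√3/2)` to the one already excluded.
    have h2 := h.reflect.rate_B_ne_zero ha1 (b := -b) (by simpa using hab) ha hb.neg hN hO
    refine lt_of_le_of_ne (by linarith) fun h3 => h2 ?_
    rw [h3]
    ring
  have hB0 : 0 < 1 + a - √3 * b := by
    have h1 := rate_nonneg (M := 2) h.dB h.B_pos
      (fun t => by linarith [h.N_le_one t, h.A_pos t]) hrB
    have h2 := h.rate_B_ne_zero ha1 hab ha hb hN hO
    exact lt_of_le_of_ne (by linarith) h2.symm
  -- Half the smaller limiting rate of `N ± P`, hence strictly below both.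
  set l := min (1 + a + √3 * b) (1 + a - √3 * b) with hl
  have hlpos : 0 < l := lt_min hA0 hB0
  obtain ⟨CA, cA, hCA, hA⟩ := exists_le_exp_of_rate (l := l) h.dA (fun t => (h.A_pos t).le) hrA
    (by have := min_le_left (1 + a + √3 * b) (1 + a - √3 * b); rw [← hl] at this; linarith)
  obtain ⟨CB, cB, hCB, hB⟩ := exists_le_exp_of_rate (l := l) h.dB (fun t => (h.B_pos t).le) hrB
    (by have := min_le_right (1 + a + √3 * b) (1 + a - √3 * b); rw [← hl] at this; linarith)
  set η := min l (2 * (1 - v)) with hη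
  have hη1 : η ≤ l := min_le_left _ _
  have hη2 : η ≤ 2 * (1 - v) := min_le_right _ _
  refine ⟨2 * C + 2 * (CA + CB) ^ 2, η, min (min cA cB) (min c 0), by positivity,
    lt_min hlpos (by positivity), fun t ht => ?_⟩
  have htA : t ≤ cA := ht.trans ((min_le_left _ _).trans (min_le_left _ _))
  have htB : t ≤ cB := ht.trans ((min_le_left _ _).trans (min_le_right _ _))
  have htc : t ≤ c := ht.trans ((min_le_right _ _).trans (min_le_left _ _))
  have ht0 : t ≤ 0 := ht.trans ((min_le_right _ _).trans (min_le_right _ _))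
  have e1 : Real.exp (4 * (1 - v) * t) ≤ Real.exp (2 * η * t) :=
    Real.exp_le_exp.2 (by nlinarith)
  have e2 : Real.exp (l * t) ^ 2 ≤ Real.exp (2 * η * t) := by
    rw [← Real.exp_nat_mul]
    exact Real.exp_le_exp.2 (by push_cast; nlinarith)
  have h1 : N t ≤ (CA + CB) * Real.exp (l * t) := by
    have h2 := hA t htA
    have h3 := hB t htB
    have h4 := h.A_pos t
    have h5 := h.B_pos t
    rw [add_mul]
    linarith
  have h2 : N t ^ 2 ≤ (CA + CB) ^ 2 * Real.exp (2 * η * t) := by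
    calc N t ^ 2 ≤ ((CA + CB) * Real.exp (l * t)) ^ 2 := pow_le_pow_left₀ (h.N_pos t).le h1 2
      _ = (CA + CB) ^ 2 * Real.exp (l * t) ^ 2 := by ring
      _ ≤ _ := by gcongr
  have h3 : O t ≤ C * Real.exp (2 * η * t) :=
    (hOC t htc).trans (mul_le_mul_of_nonneg_left e1 hC.le)
  have h4 : 2 * (1 - v) * O t ≤ 2 * O t := by nlinarith [h.v_pos, h.O_nonneg t]
  linarith

/-! ### Orbits near the Taub point `(-1, 0)`. -/

theorem d_AB (h : IsOrbit v S T P N O) (t : ℝ) : HasDerivAt (fun t => (N t + P t) * (N t - P t))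
    (2 * (2 - (2 * (1 - v) * O t + 2 * N t ^ 2) + 2 * S t) * ((N t + P t) * (N t - P t))) t :=
  ((h.dA t).mul (h.dB t)).congr_deriv (by ring)

theorem d_log_AB (h : IsOrbit v S T P N O) (t : ℝ) :
    HasDerivAt (fun t => Real.log ((N t + P t) * (N t - P t)))
    (2 * (2 - (2 * (1 - v) * O t + 2 * N t ^ 2) + 2 * S t)) t := by
  have hne := (mul_pos (h.A_pos t) (h.B_pos t)).ne'
  exact ((h.d_AB t).log hne).congr_deriv (mul_div_cancel_right₀ _ hne)

theorem d_log_O (h : IsOrbit v S T P N O) {t : ℝ} (ht : 0 < O t) :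
    HasDerivAt (fun t => Real.log (O t)) (4 * (1 - v) * (1 - O t) - 4 * N t ^ 2) t :=
  ((h.dO t).log ht.ne').congr_deriv (mul_div_cancel_right₀ _ ht.ne')

theorem O_lt_two_mul (h : IsOrbit v S T P N O) (t : ℝ) : O t < 2 * (1 + S t) := by
  linarith [h.N_sq_add_O_le t, pow_pos (h.N_pos t) 2]

theorem N_sq_le_two_mul (h : IsOrbit v S T P N O) (t : ℝ) : N t ^ 2 ≤ 2 * (1 + S t) := by
  linarith [h.N_sq_add_O_le t, h.O_nonneg t]

/-- With `p = 1 + S`: if `O > p/2` persisted while `p` is small, then `p' ≥ (1 - v)p/2` and `p`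
would decay exponentially in the past. Since `(log AB)' ≤ 4p`, the product `AB` would stay bounded
below, contradicting `AB ≤ N² ≤ 2p`. -/
theorem exists_O_le_half_of_small (h : IsOrbit v S T P N O) {c : ℝ}
    (hc : 1 + S c < (1 - v) ^ 2 / 300) :
    ∃ t ≤ c, 1 + S t < (1 - v) ^ 2 / 300 ∧ O t ≤ (1 + S t) / 2 := by
  by_contra! H
  have hw : 0 < 1 - v := by linarith [h.v_lt]
  have hw1 : 1 - v < 1 := by linarith [h.v_pos]
  set w := 1 - v
  have hεw : w ^ 2 / 300 ≤ w / 300 := by nlinarith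
  have key : ∀ t ≤ c, 1 + S t < w ^ 2 / 300 →
      w / 2 * (1 + S t) ≤ 2 * w * O t * (1 - (1 + S t)) - 2 * N t ^ 2 * (1 + S t) := by
    intro t ht hpt
    have hp := h.p_pos t
    have hO := H t ht hpt
    have hN := h.N_sq_le_two_mul t
    have h1 : w * (1 + S t) * (1 - (1 + S t)) ≤ 2 * w * O t * (1 - (1 + S t)) := by
      apply mul_le_mul_of_nonneg_right _ (by linarith)
      nlinarith
    have h2 : N t ^ 2 * (1 + S t) ≤ 2 * (1 + S t) * (1 + S t) :=
      mul_le_mul_of_nonneg_right hN hp.le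
    have h3 : (1 + S t) * (w / 2 - w * (1 + S t) - 4 * (1 + S t)) ≥ 0 :=
      mul_nonneg hp.le (by nlinarith)
    nlinarith
  have hsmall : ∀ t ≤ c, 1 + S t ≤ 1 + S c := fun t ht =>
    le_of_deriv_nonneg_below (f := fun t => 1 + S t) (e := w ^ 2 / 300) ht (fun s _ => h.dp s)
      (fun s hs hps => le_trans (by have := h.p_pos s; positivity) (key s hs.2 hps)) hc
  have hdecay : ∀ t ≤ c, 1 + S t ≤ (1 + S c) * Real.exp (w / 2 * (t - c)) := by
    intro t ht
    refine le_exp_of_hasDerivAt (f := fun t => 1 + S t)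
      (a := fun t => (2 * w * O t * (1 - (1 + S t)) - 2 * N t ^ 2 * (1 + S t)) / (1 + S t))
      (fun s _ => (h.dp s).congr_deriv (div_mul_cancel₀ _ (h.p_pos s).ne').symm)
      (fun s _ => (h.p_pos s).le) (fun s hs => ?_) ht
    rw [le_div_iff₀ (h.p_pos s)]
    exact key s hs ((hsmall s hs).trans_lt hc)
  have hexp : ∀ t, HasDerivAt (fun t => Real.exp (w / 2 * (t - c)))
      (w / 2 * Real.exp (w / 2 * (t - c))) t := fun t =>
    ((((hasDerivAt_id t).sub_const c).const_mul (w / 2)).exp).congr_deriv (by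
      simp only [id]; ring)
  -- The integral over `(-∞, c]` of `4 (1 + S c) exp(w/2 (s - c))`, which bounds the total growth of
  -- `log AB`.
  set K := 8 * (1 + S c) / w with hK
  have hKpos : 0 < K := by
    have := h.p_pos c
    positivity
  have hE : ∀ t ≤ c, Real.exp (Real.log ((N c + P c) * (N c - P c)) - K)
      ≤ 2 * (1 + S c) * Real.exp (w / 2 * (t - c)) := by
    intro t ht
    have h1 := mono_of_hasDerivAt (c := c)
      (fun t _ => ((hexp t).const_mul K).sub (h.d_log_AB t)) (fun s hs => by
        have h2 : K * (w / 2 * Real.exp (w / 2 * (s - c)))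
            = 4 * ((1 + S c) * Real.exp (w / 2 * (s - c))) := by
          rw [hK]; field_simp; ring
        rw [h2]
        have h3 := hdecay s hs
        have h4 : 0 ≤ 2 * w * O s + 2 * N s ^ 2 := by
          have := h.O_nonneg s
          positivity
        linarith) ht le_rfl
    simp only [Pi.sub_apply, sub_self, mul_zero, Real.exp_zero, mul_one] at h1
    have h2 : 0 < K * Real.exp (w / 2 * (t - c)) := by positivity
    have hpos := mul_pos (h.A_pos t) (h.B_pos t)
    have h3 : Real.exp (Real.log ((N c + P c) * (N c - P c)) - K)
        ≤ (N t + P t) * (N t - P t) := by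
      rw [← Real.le_log_iff_exp_le hpos]
      linarith
    refine h3.trans ?_
    have h4 := h.N_sq_le_two_mul t
    have h5 := hdecay t ht
    nlinarith [sq_nonneg (P t)]
  have hlim : Tendsto (fun t => 2 * (1 + S c) * Real.exp (w / 2 * (t - c))) atBot (𝓝 0) := by
    have := (tendsto_exp_mul_atBot (half_pos hw)).comp
      (tendsto_atBot_add_const_right atBot (-c) tendsto_id)
    simpa [sub_eq_add_neg] using this.const_mul (2 * (1 + S c))
  have := ge_of_tendsto hlim (eventually_atBot.2 ⟨c, hE⟩)
  exact absurd this (not_le.2 (Real.exp_pos _))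

/-- Orbits that come close to the Taub point `(-1, 0)` enter the trapping region. -/
theorem exists_trap_of_small (h : IsOrbit v S T P N O) {c : ℝ}
    (hc : 1 + S c < (1 - v) ^ 2 / 300) : ∃ t ≤ c, O t < (1 + S t) ^ 2 / 2 := by
  obtain ⟨c, hcc, hc, hOc⟩ := h.exists_O_le_half_of_small hc
  by_contra! H'
  have H : ∀ t ≤ c, (1 + S t) ^ 2 / 2 ≤ O t := fun t ht => H' t (ht.trans hcc)
  have hw : 0 < 1 - v := by linarith [h.v_lt]
  have hw1 : 1 - v < 1 := by linarith [h.v_pos]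
  set w := 1 - v
  have hεw : w ^ 2 / 300 ≤ w / 300 := by nlinarith
  have hO : ∀ t ≤ c, 0 < O t := fun t ht =>
    lt_of_lt_of_le (by have := h.p_pos t; positivity) (H t ht)
  have hpc := h.p_pos c
  set p := 1 + S c with hp
  -- Since `(1 + S)' ≥ -8 (1 + S)²`, on a window of this length `1/(1 + S)` loses at most half its
  -- final value, so `1 + S` at most doubles.
  set a := c - 1 / (16 * p) with ha
  have hac : a ≤ c := by
    have : 0 < 1 / (16 * p) := by positivity
    linarith
  have hwin : ∀ t, a ≤ t → t ≤ c → 1 + S t ≤ 2 * p := by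
    intro t hat htc
    have hpt := h.p_pos t
    have h1 := mono_of_hasDerivAt (c := c) (fun t _ =>
      ((hasDerivAt_id t).const_mul 8).sub ((h.dp t).inv (h.p_pos t).ne')) (fun s _ => by
        have hps := h.p_pos s
        rw [neg_div, mul_one, sub_neg_eq_add]
        have hN := mul_le_mul_of_nonneg_right (h.N_sq_le_two_mul s) hps.le
        have hO' := h.O_lt_two_mul s
        have hO0 := h.O_nonneg s
        have h2 : -(4 * (1 + S s) ^ 2) ≤ 2 * w * O s * (1 - (1 + S s)) := by
          rcases le_total (1 + S s) 1 with h3 | h3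
          · have : 0 ≤ 2 * w * O s * (1 - (1 + S s)) :=
              mul_nonneg (by positivity) (by linarith)
            nlinarith [sq_nonneg (1 + S s)]
          · have : 2 * w * O s * ((1 + S s) - 1) ≤ 2 * 1 * (2 * (1 + S s)) * (1 + S s) := by
              gcongr
              linarith
            linarith
        have h3 : -8 ≤ (2 * (1 - v) * O s * (1 - (1 + S s)) - 2 * N s ^ 2 * (1 + S s))
            / (1 + S s) ^ 2 := by
          rw [le_div_iff₀ (by positivity)]
          linarith
        linarith) htc le_rfl
    simp only [Pi.sub_apply, Pi.inv_apply, id, ← hp] at h1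
    have h2 : 8 * (1 / (16 * p)) = p⁻¹ / 2 := by field_simp; norm_num
    have h3 : p⁻¹ / 2 ≤ (1 + S t)⁻¹ := by linarith
    have h4 : p⁻¹ / 2 = (2 * p)⁻¹ := by field_simp
    rw [h4] at h3
    exact (inv_le_inv₀ (by positivity) hpt).1 h3
  have hy : ∀ t, a ≤ t → t ≤ c → O t / (1 + S t) ≤ 1 / 2 := by
    intro t hat htc
    have h1 : O c / (1 + S c) ≤ 1 / 2 := by
      rw [div_le_iff₀ hpc]
      linarith
    refine le_trans ?_ h1
    -- For small `1 + S` the ratio is increasing wherever it is below `3/4`, so going backwards it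
    -- cannot exceed its value at `c`.
    refine le_of_deriv_nonneg_below (f := fun t => O t / (1 + S t))
      (f' := fun t => O t / (1 + S t) * (2 * w * (2 - O t - O t / (1 + S t)) - 2 * N t ^ 2))
      (e := 3 / 4) htc (fun s hs => ?_) (fun s hs hes => ?_) (by linarith)
    · have hps := (h.p_pos s).ne'
      refine ((h.dO s).div (h.dp s) hps).congr_deriv ?_
      field_simp
      ring
    · have hps := h.p_pos s
      have h2 := hwin s (hat.trans hs.1) hs.2
      have h3 := h.O_lt_two_mul s
      have h4 := h.N_sq_le_two_mul s
      have h5 := h.O_nonneg s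
      refine mul_nonneg (div_nonneg h5 hps.le) ?_
      nlinarith
  -- The logarithmic derivative of `O/(1 + S)²` is `4w(1 - O/(1 + S)) ≥ 2w` on the window. The
  -- quotient thus falls backwards by the factor `exp(w/(8p))`, whereas avoiding the trap keeps it
  -- at least `1/2`.
  have hlog : Real.log (O a) - 2 * Real.log (1 + S a) - 2 * w * a
      ≤ Real.log (O c) - 2 * Real.log (1 + S c) - 2 * w * c := by
    refine le_of_hasDerivAt_nonneg (f := fun t => Real.log (O t) - 2 * Real.log (1 + S t)
      - 2 * w * t) (f' := fun t => (4 * (1 - v) * (1 - O t) - 4 * N t ^ 2)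
        - 2 * ((2 * (1 - v) * O t * (1 - (1 + S t)) - 2 * N t ^ 2 * (1 + S t)) / (1 + S t))
        - 2 * w * 1) hac (fun t ht => ((h.d_log_O (hO t ht.2)).sub
          (((h.dp t).log (h.p_pos t).ne').const_mul 2)).sub ((hasDerivAt_id t).const_mul _))
      (fun t ht => ?_)
    have h2 := hy t ht.1.le ht.2.le
    have h3 : (4 * (1 - v) * (1 - O t) - 4 * N t ^ 2)
        - 2 * ((2 * (1 - v) * O t * (1 - (1 + S t)) - 2 * N t ^ 2 * (1 + S t)) / (1 + S t))
        - 2 * w * 1 = 2 * w * (1 - 2 * (O t / (1 + S t))) := by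
      have := (h.p_pos t).ne'
      field_simp
      ring
    rw [h3]
    exact mul_nonneg (by positivity) (by linarith)
  have hlow : -Real.log 2 ≤ Real.log (O a) - 2 * Real.log (1 + S a) := by
    have hpa := h.p_pos a
    have h2 := Real.log_le_log (by positivity) (H a hac)
    rw [Real.log_div (by positivity) two_ne_zero, Real.log_pow] at h2
    push_cast at h2
    linarith
  have hup : Real.log (O c) - 2 * Real.log (1 + S c) ≤ -Real.log 2 + Real.log p⁻¹ := by
    have h2 := Real.log_le_log (hO c le_rfl) hOc
    rw [Real.log_div hpc.ne' two_ne_zero] at h2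
    rw [Real.log_inv, ← hp]
    linarith
  have hfin : w / 8 * p⁻¹ ≤ Real.log p⁻¹ := by
    have h2 : 2 * w * (c - a) = w / 8 * p⁻¹ := by
      rw [ha]; field_simp; ring
    linarith
  -- What remains is `w/(8p) ≤ log(1/p) ≤ 2(s - 1)`, which forces `w s < 16`. The constant `300 >
  -- 17²` in the hypothesis gives `w s > 17`.
  set s := √(p⁻¹) with hs
  have hspos : 0 < s := Real.sqrt_pos.2 (by positivity)
  have hs2 : p⁻¹ = s ^ 2 := (Real.sq_sqrt (by positivity)).symm
  have hsw : 17 < w * s := by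
    have h2 : 300 < (w * s) ^ 2 := by
      rw [mul_pow, ← hs2, ← div_eq_mul_inv, lt_div_iff₀ hpc]
      linarith
    nlinarith [mul_pos hw hspos]
  have h2 : Real.log p⁻¹ ≤ 2 * (s - 1) := by
    rw [hs2, Real.log_pow]
    push_cast
    linarith [Real.log_le_sub_one_of_pos hspos]
  rw [hs2] at hfin h2
  nlinarith

/-! ### Orbits with `Ω` bounded below, and convergence to `F`. -/

/-- Smooth functions of the state have bounded derivative along an orbit. -/
theorem exists_deriv_bound (h : IsOrbit v S T P N O) {φ : ℝ × ℝ × ℝ × ℝ × ℝ → ℝ}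
    (hφ : ContDiff ℝ 1 φ) : ∃ (f' : ℝ → ℝ) (K : ℝ),
      (∀ t, HasDerivAt (fun t => φ (S t, T t, P t, N t, O t)) (f' t) t) ∧ ∀ t, |f' t| ≤ K := by
  let V : ℝ × ℝ × ℝ × ℝ × ℝ → ℝ × ℝ × ℝ × ℝ × ℝ := fun x =>
    (-(2 * (1 - v) * x.2.2.2.2 + 2 * x.2.2.2.1 ^ 2) * x.1 - 2 * x.2.2.2.1 ^ 2,
      -(2 * (1 - v) * x.2.2.2.2 + 2 * x.2.2.2.1 ^ 2) * x.2.1 - 2 * √3 * x.2.2.1 * x.2.2.2.1,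
      (2 - (2 * (1 - v) * x.2.2.2.2 + 2 * x.2.2.2.1 ^ 2) + 2 * x.1) * x.2.2.1
        + 2 * √3 * x.2.1 * x.2.2.2.1,
      (2 - (2 * (1 - v) * x.2.2.2.2 + 2 * x.2.2.2.1 ^ 2) + 2 * x.1) * x.2.2.2.1
        + 2 * √3 * x.2.1 * x.2.2.1,
      (4 * (1 - v) * (1 - x.2.2.2.2) - 4 * x.2.2.2.1 ^ 2) * x.2.2.2.2)
  have hV : Continuous V := by fun_prop
  have hg : Continuous fun x => fderiv ℝ φ x (V x) :=
    (hφ.continuous_fderiv one_ne_zero).clm_apply hV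
  obtain ⟨K, hK⟩ := h.exists_bound hg
  refine ⟨fun t => fderiv ℝ φ (S t, T t, P t, N t, O t) (V (S t, T t, P t, N t, O t)), K,
    fun t => ?_, hK⟩
  have hX : HasDerivAt (fun t => (S t, T t, P t, N t, O t)) (V (S t, T t, P t, N t, O t)) t :=
    (h.dS t).prodMk ((h.dT t).prodMk ((h.dP t).prodMk ((h.dN t).prodMk (h.dO t))))
  exact ((hφ.differentiable one_ne_zero) _).hasFDerivAt.comp_hasDerivAt t hX

/-- Limits how fast `N` can grow backwards in time, so a small `N` stays small over a past window of
fixed length. -/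
theorem neg_six_le_rate (h : IsOrbit v S T P N O) (t : ℝ) :
    -6 ≤ ((2 - (2 * (1 - v) * O t + 2 * N t ^ 2) + 2 * S t) * N t
      + 2 * √3 * T t * P t) / N t := by
  have hN := h.N_pos t
  rw [le_div_iff₀ hN]
  have h3 : √3 ≤ 2 := by rw [Real.sqrt_le_left (by norm_num)]; norm_num
  have h1 : |2 * √3 * T t * P t| ≤ 4 * N t := by
    rw [abs_mul, abs_mul, abs_of_nonneg (by positivity : 0 ≤ 2 * √3)]
    calc 2 * √3 * |T t| * |P t| ≤ 2 * 2 * 1 * N t := by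
          gcongr
          · exact (h.abs_T_lt t).le
          · exact (h.abs_lt t).le
      _ = _ := by ring
  have h2 : -2 ≤ 2 - (2 * (1 - v) * O t + 2 * N t ^ 2) + 2 * S t := by
    nlinarith [h.constraint t, h.O_nonneg t, h.v_pos, sq_nonneg (T t), sq_nonneg (S t),
      (_root_.abs_lt.1 (h.abs_S_lt t)).1, mul_nonneg h.v_pos.le (h.O_nonneg t)]
  have h4 := (abs_le.1 h1).1
  nlinarith

theorem dN' (h : IsOrbit v S T P N O) (t : ℝ) : HasDerivAt N
    (((2 - (2 * (1 - v) * O t + 2 * N t ^ 2) + 2 * S t) * N t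
      + 2 * √3 * T t * P t) / N t * N t) t :=
  (h.dN t).congr_deriv (div_mul_cancel₀ _ (h.N_pos t).ne').symm

/-- If `Ω` is bounded below in the past, then `Ω` is close to `1` where `N₋` is small. -/
theorem exists_one_sub_O_lt (h : IsOrbit v S T P N O) {ω : ℝ} (hω : 0 < ω)
    (hO : ∀ t ≤ 0, ω ≤ O t) {δ : ℝ} (hδ : 0 < δ) :
    ∃ n, 0 < n ∧ ∀ t ≤ 0, N t ^ 2 < n → 1 - O t < δ := by
  have hw : 0 < 1 - v := by linarith [h.v_lt]
  set w := 1 - v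
  -- While `1 - O ≥ δ` and `N² ≤ wδ/2`, `O` grows at rate at least `2wδω`. Over time `L` it would
  -- gain `2`, impossible in `[0, 1]`. The factor `exp(-12L)` below pays for the growth of `N²` at
  -- backward rate `12`.
  set L := 1 / (w * δ * ω) with hL
  have hLpos : 0 < L := by positivity
  refine ⟨w * δ / 2 * Real.exp (-(12 * L)), by positivity, fun t ht hn => ?_⟩
  by_contra! hlt
  have hNs : ∀ s ∈ Set.Icc (t - L) t, N s ^ 2 ≤ w * δ / 2 := by
    intro s hs
    have h1 := le_exp_of_hasDerivAt (c := t) (l := -6) (fun s _ => h.dN' s)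
      (fun s _ => (h.N_pos s).le) (fun s _ => h.neg_six_le_rate s) hs.2
    have h2 : N s ≤ N t * Real.exp (6 * L) := h1.trans
      (mul_le_mul_of_nonneg_left (Real.exp_le_exp.2 (by linarith [hs.1])) (h.N_pos t).le)
    calc N s ^ 2 ≤ (N t * Real.exp (6 * L)) ^ 2 := pow_le_pow_left₀ (h.N_pos s).le h2 2
      _ = N t ^ 2 * Real.exp (12 * L) := by
          rw [mul_pow, ← Real.exp_nat_mul]; push_cast; ring_nf
      _ ≤ w * δ / 2 * Real.exp (-(12 * L)) * Real.exp (12 * L) := by gcongr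
      _ = w * δ / 2 := by rw [mul_assoc, ← Real.exp_add]; simp
  have hOs : ∀ s ∈ Set.Icc (t - L) t, O s ≤ 1 - δ := by
    intro s hs
    refine le_trans (le_of_deriv_nonneg_below (e := 1 - δ / 2) hs.2 (fun r _ => h.dO r)
      (fun r hr hre => ?_) (by linarith)) (by linarith : O t ≤ 1 - δ)
    have h1 := hNs r ⟨hs.1.trans hr.1, hr.2⟩
    refine mul_nonneg ?_ (h.O_nonneg r)
    have h2 : 4 * w * (δ / 2) ≤ 4 * w * (1 - O r) :=
      mul_le_mul_of_nonneg_left (by linarith) (by positivity)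
    linarith
  have h1 : O (t - L) - 2 * w * δ * ω * (t - L) ≤ O t - 2 * w * δ * ω * t := by
    refine le_of_hasDerivAt_nonneg (f := fun x => O x - 2 * w * δ * ω * x) (by linarith)
      (fun x _ => (h.dO x).sub ((hasDerivAt_id x).const_mul _)) (fun x hx => ?_)
    have h2 := hNs x ⟨hx.1.le, hx.2.le⟩
    have h3 := hOs x ⟨hx.1.le, hx.2.le⟩
    have h4 := hO x (hx.2.le.trans ht)
    have h5 : 4 * w * δ ≤ 4 * w * (1 - O x) :=
      mul_le_mul_of_nonneg_left (by linarith) (by positivity)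
    have h6 : 2 * w * δ * ω ≤ (4 * w * (1 - O x) - 4 * N x ^ 2) * O x :=
      mul_le_mul (by linarith) h4 hω.le (by
        have : 0 < w * δ := by positivity
        linarith)
    linarith
  have h2 : 2 * w * δ * ω * L = 2 := by rw [hL]; field_simp
  have h3 := hO (t - L) (by linarith)
  have h4 := h.O_le_one t
  linarith

/-- If `Ω` is bounded below in the past, then either the orbit converges to `F` in the past,
or `N₋` is bounded below. -/
theorem tendsto_F_or (h : IsOrbit v S T P N O) {ω : ℝ} (hω : 0 < ω) (hO : ∀ t ≤ 0, ω ≤ O t) :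
    (Tendsto S atBot (𝓝 0) ∧ Tendsto T atBot (𝓝 0) ∧ Tendsto P atBot (𝓝 0) ∧
      Tendsto N atBot (𝓝 0) ∧ Tendsto O atBot (𝓝 1)) ∨ ∃ n, 0 < n ∧ ∀ t ≤ 0, n ≤ N t ^ 2 := by
  have hv := h.v_pos
  -- Where `1 - O < (v/8)²`, the constraint gives `|S|, |T| ≤ v/8`. This is close enough to `F`,
  -- where `N` has rate `2v`, to keep the rate above `v`.
  obtain ⟨n, hn, hnO⟩ := h.exists_one_sub_O_lt hω hO (δ := (v / 8) ^ 2) (by positivity)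
  by_cases hcase : ∀ t ≤ 0, n ≤ N t ^ 2
  · exact Or.inr ⟨n, hn, hcase⟩
  left
  push Not at hcase
  obtain ⟨c, hc0, hc⟩ := hcase
  have hrate : ∀ t ≤ c, N t ^ 2 < n → v ≤ ((2 - (2 * (1 - v) * O t + 2 * N t ^ 2) + 2 * S t) * N t
      + 2 * √3 * T t * P t) / N t := by
    intro t ht hnt
    have hN := h.N_pos t
    have h1 := hnO t (ht.trans hc0) hnt
    have hcon := h.constraint t
    have hS : |S t| ≤ v / 8 := abs_le_of_sq_le_sq (by nlinarith [sq_nonneg (T t), sq_nonneg (N t)])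
      (by positivity)
    have hT : |T t| ≤ v / 8 := abs_le_of_sq_le_sq (by nlinarith [sq_nonneg (S t), sq_nonneg (N t)])
      (by positivity)
    have h3 : √3 ≤ 2 := by rw [Real.sqrt_le_left (by norm_num)]; norm_num
    have h4 : |2 * √3 * T t * P t| ≤ v / 2 * N t := by
      rw [abs_mul, abs_mul, abs_of_nonneg (by positivity : 0 ≤ 2 * √3)]
      calc 2 * √3 * |T t| * |P t| ≤ 2 * 2 * (v / 8) * N t := by
            gcongr
            exact (h.abs_lt t).le
        _ = _ := by ring
    rw [le_div_iff₀ hN]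
    have h5 : 3 / 2 * v ≤ 2 - (2 * (1 - v) * O t + 2 * N t ^ 2) + 2 * S t := by
      have h6 : 2 * v * (1 - (v / 8) ^ 2) ≤ 2 * v * O t :=
        mul_le_mul_of_nonneg_left (by linarith) (by positivity)
      have h7 : 2 * v * (1 - (v / 8) ^ 2) ≥ 2 * v - v / 4 := by
        have : v ^ 2 ≤ 1 := by nlinarith [h.v_lt]
        nlinarith
      nlinarith [sq_nonneg (S t), sq_nonneg (T t), (abs_le.1 hS).1]
    have h8 := (abs_le.1 h4).1
    nlinarith
  have hsmall : ∀ t ≤ c, N t ^ 2 < n := by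
    intro t ht
    refine lt_of_le_of_lt (le_of_deriv_nonneg_below (f := fun t => N t ^ 2) (e := n) ht
      (fun s _ => (h.dN' s).pow 2) (fun s hs hsn => ?_) hc) hc
    have h1 := hrate s hs.2 hsn
    have h2 := h.N_pos s
    have h3 : 0 ≤ ((2 - (2 * (1 - v) * O s + 2 * N s ^ 2) + 2 * S s) * N s
      + 2 * √3 * T s * P s) / N s := hv.le.trans h1
    push_cast
    positivity
  have hN : Tendsto N atBot (𝓝 0) := by
    refine tendsto_of_tendsto_of_tendsto_of_le_of_le'
      (h := fun t => N c * Real.exp (-(v * c)) * Real.exp (v * t)) tendsto_const_nhds ?_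
      (Eventually.of_forall fun t => (h.N_pos t).le) (eventually_atBot.2 ⟨c, fun t ht => ?_⟩)
    · simpa using (tendsto_exp_mul_atBot hv).const_mul (N c * Real.exp (-(v * c)))
    · rw [mul_assoc, ← exp_mul_sub]
      exact le_exp_of_hasDerivAt (fun s _ => h.dN' s) (fun s _ => (h.N_pos s).le)
        (fun s hs => hrate s hs (hsmall s hs)) ht
  have hO1 : Tendsto (fun t => 1 - O t) atBot (𝓝 0) := by
    rw [Metric.tendsto_nhds]
    intro δ hδ
    obtain ⟨m, hm, hmO⟩ := h.exists_one_sub_O_lt hω hO hδ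
    have hN2 : Tendsto (fun t => N t ^ 2) atBot (𝓝 0) := by simpa using hN.pow 2
    filter_upwards [hN2.eventually_lt_const hm, eventually_le_atBot 0] with t ht ht0
    rw [Real.dist_eq, sub_zero, abs_of_nonneg (by linarith [h.O_le_one t])]
    exact hmO t ht0 ht
  have hsq := hO1.sqrt
  rw [Real.sqrt_zero] at hsq
  refine ⟨squeeze_zero_norm (fun t => ?_) hsq, squeeze_zero_norm (fun t => ?_) hsq,
    squeeze_zero_norm (fun t => (h.abs_lt t).le) hN, hN, ?_⟩
  · exact Real.abs_le_sqrt (by nlinarith [h.constraint t, sq_nonneg (T t), sq_nonneg (N t)])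
  · exact Real.abs_le_sqrt (by nlinarith [h.constraint t, sq_nonneg (S t), sq_nonneg (N t)])
  · simpa using hO1.const_sub 1

end IsOrbit
-- The type VI₀ monotone function and the equilibrium `P₁⁺(VI₀)`.
/-- The logarithm of the monotone function
`(N₋² - N₊²)^v Ω / (1 + v Σ₊)^(2 (1 + v))` of the Bianchi type VI₀ equations. -/
noncomputable def logZ (v S P N O : ℝ) : ℝ :=
  v * Real.log ((N + P) * (N - P)) + Real.log O - 2 * (1 + v) * Real.log (1 + v * S)

theorem one_add_mul_pos {v s : ℝ} (hv0 : 0 < v) (hv1 : v < 1) (hs : |s| ≤ 1) : 0 < 1 + v * s := by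
  have := abs_le.1 hs
  nlinarith

/-- `logZ` is maximal at `P₁⁺(VI₀)`. -/
theorem logZ_le {v S T P N O : ℝ} (hv0 : 0 < v) (hv1 : v < 1) (hS : |S| ≤ 1) (hO : 0 < O)
    (hP : |P| < N) (hc : O + S ^ 2 + T ^ 2 + N ^ 2 = 1) :
    logZ v S P N O ≤ v * Real.log (v * (1 - v)) + Real.log (1 - v)
      - 2 * (1 + v) * Real.log (1 - v ^ 2) := by
  have hw : 0 < 1 - v := by linarith
  have hP' := abs_lt.1 hP
  have hN : 0 < N := by linarith [abs_nonneg P]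
  have hW := one_add_mul_pos hv0 hv1 hS
  have hAB : 0 < (N + P) * (N - P) := mul_pos (by linarith) (by linarith)
  have h1 : Real.log ((N + P) * (N - P)) ≤ Real.log (N ^ 2) :=
    Real.log_le_log hAB (by nlinarith [sq_nonneg P])
  -- Weighted AM-GM: use `log x ≤ x - 1` at `N²/(vc)` and `O/c` with weights `v` and `1`. This `c`
  -- makes the right-hand sides cancel.
  set c := (N ^ 2 + O) / (1 + v) with hcdef
  have hcpos : 0 < c := by positivity
  have hN2 : 0 < N ^ 2 := by positivity
  have h2 : Real.log (N ^ 2) - Real.log v - Real.log c ≤ N ^ 2 / (v * c) - 1 := by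
    have := Real.log_le_sub_one_of_pos (x := N ^ 2 / (v * c)) (by positivity)
    rwa [Real.log_div hN2.ne' (by positivity), Real.log_mul hv0.ne' hcpos.ne', ← sub_sub] at this
  have h3 : Real.log O - Real.log c ≤ O / c - 1 := by
    have := Real.log_le_sub_one_of_pos (x := O / c) (by positivity)
    rwa [Real.log_div hO.ne' hcpos.ne'] at this
  have h4 : v * (N ^ 2 / (v * c) - 1) + (O / c - 1) = 0 := by
    rw [hcdef]; field_simp; ring
  -- By the constraint, `(1 + vS)² - (1 - v²)(N² + O) = (S + v)² + (1 - v²)T²`.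
  have h5 : Real.log c + Real.log (1 + v) + Real.log (1 - v ^ 2) ≤ 2 * Real.log (1 + v * S) := by
    have hv2 : 0 < 1 - v ^ 2 := by nlinarith
    rw [← Real.log_mul hcpos.ne' (by positivity), ← Real.log_mul (by positivity) hv2.ne']
    have : Real.log ((1 + v * S) ^ 2) = 2 * Real.log (1 + v * S) := by
      rw [Real.log_pow]; norm_num
    rw [← this]
    apply Real.log_le_log (by positivity)
    rw [hcdef, div_mul_cancel₀ _ (by positivity)]
    have : N ^ 2 + O = 1 - S ^ 2 - T ^ 2 := by linarith
    rw [this]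
    nlinarith [sq_nonneg (S + v), mul_nonneg hv2.le (sq_nonneg T)]
  have h6 : Real.log (1 - v ^ 2) = Real.log (1 - v) + Real.log (1 + v) := by
    rw [← Real.log_mul hw.ne' (by positivity)]; ring_nf
  have h7 : Real.log (v * (1 - v)) = Real.log v + Real.log (1 - v) :=
    Real.log_mul hv0.ne' hw.ne'
  have h8 := mul_le_mul_of_nonneg_left (h1.trans (by linarith :
    Real.log (N ^ 2) ≤ Real.log v + Real.log c + (N ^ 2 / (v * c) - 1))) hv0.le
  have h9 := mul_le_mul_of_nonneg_left h5 (by linarith : 0 ≤ 1 + v)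
  unfold logZ
  rw [h7]
  rw [h6] at h9 ⊢
  nlinarith

namespace IsOrbit

variable {v : ℝ} {S T P N O : ℝ → ℝ}

/-- Eliminating `O` by the constraint turns the derivative into a sum of squares that vanishes only
at `S = -v`, `T = 0`. -/
theorem d_logZ (h : IsOrbit v S T P N O) {t : ℝ} (hO : 0 < O t) :
    HasDerivAt (fun t => logZ v (S t) (P t) (N t) (O t))
      (4 / (1 + v * S t) * ((1 - v ^ 2) * T t ^ 2 + (S t + v) ^ 2)) t := by
  have hW := one_add_mul_pos h.v_pos h.v_lt (h.abs_S_lt t).le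
  refine ((((h.d_log_AB t).const_mul v).add (h.d_log_O hO)).sub
    (((((h.dS t).const_mul v).const_add 1).log hW.ne').const_mul _)).congr_deriv ?_
  have hc : O t = 1 - S t ^ 2 - T t ^ 2 - N t ^ 2 := by linarith [h.constraint t]
  rw [hc]
  field_simp
  ring

theorem le_d_logZ (h : IsOrbit v S T P N O) (t : ℝ) :
    2 * ((1 - v ^ 2) * T t ^ 2 + (S t + v) ^ 2) ≤
      4 / (1 + v * S t) * ((1 - v ^ 2) * T t ^ 2 + (S t + v) ^ 2) := by
  have hW := one_add_mul_pos h.v_pos h.v_lt (h.abs_S_lt t).le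
  have hv2 : 0 < 1 - v ^ 2 := by nlinarith [h.v_pos, h.v_lt]
  apply mul_le_mul_of_nonneg_right _ (by positivity)
  rw [le_div_iff₀ hW]
  nlinarith [h.v_pos, h.v_lt, (_root_.abs_lt.1 (h.abs_S_lt t)).2]

theorem logZ_mono (h : IsOrbit v S T P N O) (hO : ∀ t, 0 < O t) {a b : ℝ} (hab : a ≤ b) :
    logZ v (S a) (P a) (N a) (O a) ≤ logZ v (S b) (P b) (N b) (O b) :=
  mono_of_hasDerivAt (f := fun t => logZ v (S t) (P t) (N t) (O t)) (c := b)
    (fun t _ => h.d_logZ (hO t)) (fun t _ => by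
      have hv2 : 0 < 1 - v ^ 2 := by nlinarith [h.v_pos, h.v_lt]
      exact le_trans (by positivity) (h.le_d_logZ t)) hab le_rfl

/-- If the monotone function is bounded below by a positive constant in the past, the orbit
converges to `P₁⁺(VI₀)` in the past. -/
theorem tendsto_P1_of_le_logZ (h : IsOrbit v S T P N O) (hO : ∀ t, 0 < O t) {m : ℝ}
    (hm : ∀ t ≤ 0, m ≤ logZ v (S t) (P t) (N t) (O t)) :
    Tendsto S atBot (𝓝 (-v)) ∧ Tendsto P atBot (𝓝 0) ∧ Tendsto N atBot (𝓝 √(v * (1 - v))) ∧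
      Tendsto O atBot (𝓝 (1 - v)) := by
  have hv := h.v_pos
  have hw : 0 < 1 - v := by linarith [h.v_lt]
  have hv2 : 0 < 1 - v ^ 2 := by nlinarith
  obtain ⟨g', K, hg', hK⟩ := h.exists_deriv_bound
    (φ := fun x => 2 * ((1 - v ^ 2) * x.2.1 ^ 2 + (x.1 + v) ^ 2)) (by fun_prop)
  have hg := tendsto_zero_of_le_deriv (c := 0) (fun t _ => h.d_logZ (hO t)) (fun t _ => hg' t)
    (fun t _ => by positivity) (fun t _ => h.le_d_logZ t) (fun t _ => hK t) hm
  have hT2 : Tendsto (fun t => T t ^ 2) atBot (𝓝 0) := by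
    have h1 := hg.const_mul (1 / (2 * (1 - v ^ 2)))
    rw [mul_zero] at h1
    refine squeeze_zero (fun t => sq_nonneg _) (fun t => ?_) h1
    have h2 : 1 / (2 * (1 - v ^ 2)) * (2 * ((1 - v ^ 2) * T t ^ 2 + (S t + v) ^ 2))
      = T t ^ 2 + (S t + v) ^ 2 / (1 - v ^ 2) := by field_simp
    rw [h2]
    have : 0 ≤ (S t + v) ^ 2 / (1 - v ^ 2) := by positivity
    linarith
  have hS2 : Tendsto (fun t => (S t + v) ^ 2) atBot (𝓝 0) := by
    refine squeeze_zero (fun t => sq_nonneg _) (fun t => ?_) hg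
    nlinarith [sq_nonneg (S t + v), mul_nonneg hv2.le (sq_nonneg (T t))]
  have hT : Tendsto T atBot (𝓝 0) := by
    have h1 := hT2.sqrt
    rw [Real.sqrt_zero] at h1
    exact squeeze_zero_norm (fun t => by rw [Real.sqrt_sq_eq_abs]; exact le_rfl) h1
  have hS : Tendsto S atBot (𝓝 (-v)) := by
    have h1 := hS2.sqrt
    rw [Real.sqrt_zero] at h1
    have h2 : Tendsto (fun t => S t + v) atBot (𝓝 0) :=
      squeeze_zero_norm (fun t => by rw [Real.sqrt_sq_eq_abs]; exact le_rfl) h1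
    simpa using h2.sub_const v
  -- Once `S` and `T` converge, their derivatives tend to zero. The equation for `S'` then
  -- determines the limit of `N²`, and the one for `T'` that of `P`.
  obtain ⟨s', K1, hs', hK1⟩ := h.exists_deriv_bound
    (φ := fun x => -(2 * (1 - v) * x.2.2.2.2 + 2 * x.2.2.2.1 ^ 2) * x.1 - 2 * x.2.2.2.1 ^ 2)
    (by fun_prop)
  have hdS := tendsto_deriv_zero (c := 0) (fun t _ => h.dS t) (fun t _ => hs' t)
    (fun t _ => hK1 t) hS
  obtain ⟨t', K2, ht', hK2⟩ := h.exists_deriv_bound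
    (φ := fun x => -(2 * (1 - v) * x.2.2.2.2 + 2 * x.2.2.2.1 ^ 2) * x.2.1
      - 2 * √3 * x.2.2.1 * x.2.2.2.1) (by fun_prop)
  have hdT := tendsto_deriv_zero (c := 0) (fun t _ => h.dT t) (fun t _ => ht' t)
    (fun t _ => hK2 t) hT
  have hN2 : Tendsto (fun t => N t ^ 2) atBot (𝓝 (v * (1 - v))) := by
    have h1 : Tendsto (fun t => (-(-(2 * (1 - v) * O t + 2 * N t ^ 2) * S t - 2 * N t ^ 2)
        - 2 * (1 - v) * (1 - S t ^ 2 - T t ^ 2) * S t) / (2 + 2 * v * S t)) atBot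
        (𝓝 ((-0 - 2 * (1 - v) * (1 - (-v) ^ 2 - 0) * (-v)) / (2 + 2 * v * (-v)))) :=
      (hdS.neg.sub (((((hS.pow 2).const_sub 1).sub hT2).const_mul _).mul hS)).div
        ((hS.const_mul _).const_add 2) (by nlinarith)
    have h2 : (-0 - 2 * (1 - v) * (1 - (-v) ^ 2 - 0) * (-v)) / (2 + 2 * v * (-v))
        = v * (1 - v) := by
      rw [div_eq_iff (by nlinarith)]; ring
    rw [h2] at h1
    refine h1.congr fun t => ?_
    have hW := one_add_mul_pos h.v_pos h.v_lt (h.abs_S_lt t).le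
    rw [div_eq_iff (by linarith)]
    have hc : O t = 1 - S t ^ 2 - T t ^ 2 - N t ^ 2 := by linarith [h.constraint t]
    rw [hc]
    ring
  have hN : Tendsto N atBot (𝓝 √(v * (1 - v))) :=
    hN2.sqrt.congr fun t => Real.sqrt_sq (h.N_pos t).le
  have hnpos : 0 < √(v * (1 - v)) := Real.sqrt_pos.2 (by positivity)
  have hO1 : Tendsto O atBot (𝓝 (1 - v)) := by
    have h1 := (((hS.pow 2).const_sub 1).sub hT2).sub hN2
    have h2 : 1 - (-v) ^ 2 - 0 - v * (1 - v) = 1 - v := by ring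
    rw [h2] at h1
    exact h1.congr fun t => by linarith [h.constraint t]
  refine ⟨hS, ?_, hN, hO1⟩
  have h1 : Tendsto (fun t => ((-(2 * (1 - v) * O t + 2 * N t ^ 2) * T t - 2 * √3 * P t * N t)
      + (2 * (1 - v) * O t + 2 * N t ^ 2) * T t) / (-(2 * √3) * N t)) atBot
      (𝓝 ((0 + (2 * (1 - v) * (1 - v) + 2 * (v * (1 - v))) * 0)
        / (-(2 * √3) * √(v * (1 - v))))) :=
    (hdT.add (((hO1.const_mul _).add (hN2.const_mul 2)).mul hT)).div (hN.const_mul _)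
      (by have : 0 < 2 * √3 := by positivity
          exact (mul_neg_of_neg_of_pos (neg_lt_zero.2 this) hnpos).ne)
  rw [mul_zero, add_zero, zero_div] at h1
  refine h1.congr fun t => ?_
  have := (h.N_pos t).ne'
  have h3 : √3 ≠ 0 := by positivity
  field_simp
  ring

/-- The only orbit along which the monotone function is bounded below by a positive constant in the
past is the equilibrium `P₁⁺(VI₀)`. -/
theorem eq_P1_of_le_logZ (h : IsOrbit v S T P N O) (hO : ∀ t, 0 < O t) {m : ℝ}
    (hm : ∀ t ≤ 0, m ≤ logZ v (S t) (P t) (N t) (O t)) (t : ℝ) :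
    S t = -v ∧ T t = 0 ∧ P t = 0 ∧ N t = √(v * (1 - v)) ∧ O t = 1 - v := by
  have hv := h.v_pos
  have hw : 0 < 1 - v := by linarith [h.v_lt]
  have hv2 : 0 < 1 - v ^ 2 := by nlinarith
  obtain ⟨hS, hP, hN, hO1⟩ := h.tendsto_P1_of_le_logZ hO hm
  have hsq : √(v * (1 - v)) * √(v * (1 - v)) = v * (1 - v) :=
    Real.mul_self_sqrt (by positivity)
  have hlim : Tendsto (fun t => logZ v (S t) (P t) (N t) (O t)) atBot
      (𝓝 (v * Real.log (v * (1 - v)) + Real.log (1 - v)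
        - 2 * (1 + v) * Real.log (1 - v ^ 2))) := by
    have h1 := (hN.add hP).mul (hN.sub hP)
    rw [add_zero, sub_zero, hsq] at h1
    have h2 := (hS.const_mul v).const_add 1
    have h3 : 1 + v * -v = 1 - v ^ 2 := by ring
    rw [h3] at h2
    exact (((h1.log (by positivity)).const_mul v).add (hO1.log hw.ne')).sub
      ((h2.log hv2.ne').const_mul _)
  -- The past limit is already the maximum, so a monotone function starting from it must be
  -- constant.
  have hconst : ∀ t, logZ v (S t) (P t) (N t) (O t) = v * Real.log (v * (1 - v))
      + Real.log (1 - v) - 2 * (1 + v) * Real.log (1 - v ^ 2) := fun t =>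
    le_antisymm (logZ_le hv h.v_lt (h.abs_S_lt t).le (hO t) (h.abs_lt t) (h.constraint t))
      (le_of_tendsto hlim (eventually_atBot.2 ⟨t, fun s hs => h.logZ_mono hO hs⟩))
  have hzero : ∀ t, S t = -v ∧ T t = 0 := by
    intro t
    have h1 := (h.d_logZ (hO t)).unique
      ((hasDerivAt_const t _).congr_of_eventuallyEq (Eventually.of_forall hconst))
    have h2 := h.le_d_logZ t
    rw [h1] at h2
    have h3 : 0 ≤ (1 - v ^ 2) * T t ^ 2 := by positivity
    have h4 := sq_nonneg (S t + v)
    have h5 : (S t + v) ^ 2 = 0 := by linarith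
    have h6 : (1 - v ^ 2) * T t ^ 2 = 0 := by linarith
    have h7 := pow_eq_zero_iff (two_ne_zero) |>.1 h5
    rcases mul_eq_zero.1 h6 with h8 | h8
    · exact absurd h8 hv2.ne'
    · exact ⟨by linarith, pow_eq_zero_iff (two_ne_zero) |>.1 h8⟩
  obtain ⟨hSt, hTt⟩ := hzero t
  have e1 := (h.dS t).unique ((hasDerivAt_const t (-v)).congr_of_eventuallyEq
    (Eventually.of_forall fun s => (hzero s).1))
  have e2 := (h.dT t).unique ((hasDerivAt_const t (0 : ℝ)).congr_of_eventuallyEq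
    (Eventually.of_forall fun s => (hzero s).2))
  have hc : O t = 1 - v ^ 2 - N t ^ 2 := by
    have := h.constraint t
    rw [hSt, hTt] at this
    linarith
  have hNpos := h.N_pos t
  have hN2 : N t ^ 2 = v * (1 - v) := by
    rw [hSt, hc] at e1
    have : (1 - v ^ 2) * (N t ^ 2) = (1 - v ^ 2) * (v * (1 - v)) := by linarith
    exact mul_left_cancel₀ hv2.ne' this
  refine ⟨hSt, hTt, ?_, ?_, by rw [hc, hN2]; ring⟩
  · rw [hTt] at e2
    have h3 : √3 ≠ 0 := by positivity
    have : P t * (√3 * N t) = 0 := by linarith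
    rcases mul_eq_zero.1 this with h4 | h4
    · exact h4
    · exact absurd h4 (mul_ne_zero h3 hNpos.ne')
  · rw [← hN2, Real.sqrt_sq hNpos.le]

end IsOrbit
-- The type II monotone function and the equilibria `P₂⁺(II)`, `P₃⁻(II)`.
/-- The logarithm of the monotone function of the Bianchi type II equations with `N₃ = 0`, in terms
of `s = (Σ₊ + √3 Σ₋) / 2` and `A = N₋ + N₊`. -/
noncomputable def logZII (v s A O : ℝ) : ℝ :=
  2 * (v * (1 - v) / (4 - v ^ 2)) * Real.log A + (1 - v * (1 - v) / (4 - v ^ 2)) * Real.log O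
    - 2 * Real.log (1 + v / 2 * s)

namespace IsOrbit

variable {v : ℝ} {S T P N O : ℝ → ℝ}

theorem d_rot (h : IsOrbit v S T P N O) (t : ℝ) : HasDerivAt (fun t => (S t + √3 * T t) / 2)
    (-(2 * (1 - v) * O t + 2 * N t ^ 2) * ((S t + √3 * T t) / 2) - N t ^ 2 - 3 * P t * N t) t :=
  (((h.dS t).add ((h.dT t).const_mul √3)).div_const 2).congr_deriv (by
    have s3 : √3 ^ 2 = (3 : ℝ) := Real.sq_sqrt (by norm_num)
    linear_combination (-P t * N t) * s3)

theorem rot_sq_add (S T : ℝ) :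
    ((S + √3 * T) / 2) ^ 2 + ((√3 * S - T) / 2) ^ 2 = S ^ 2 + T ^ 2 := by
  have s3 : √3 ^ 2 = (3 : ℝ) := Real.sq_sqrt (by norm_num)
  linear_combination ((S ^ 2 + T ^ 2) / 4) * s3

theorem abs_rot_le (h : IsOrbit v S T P N O) (t : ℝ) : |(S t + √3 * T t) / 2| ≤ 1 := by
  rw [← sq_le_one_iff_abs_le_one]
  nlinarith [rot_sq_add (S t) (T t), sq_nonneg ((√3 * S t - T t) / 2), h.constraint t,
    h.O_nonneg t, sq_nonneg (N t)]

theorem rot_pos (h : IsOrbit v S T P N O) (t : ℝ) : 1 / 2 ≤ 1 + v / 2 * ((S t + √3 * T t) / 2) := by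
  have := abs_le.1 (h.abs_rot_le t)
  nlinarith [h.v_pos, h.v_lt]

theorem rot_le (h : IsOrbit v S T P N O) (t : ℝ) : 1 + v / 2 * ((S t + √3 * T t) / 2) ≤ 2 := by
  have := abs_le.1 (h.abs_rot_le t)
  nlinarith [h.v_pos, h.v_lt]

/-- The first summand is a sum of squares. The last one is the defect from type II, and vanishes
when `N = P`. -/
theorem d_logZII (h : IsOrbit v S T P N O) {t : ℝ} (hO : 0 < O t) :
    HasDerivAt (fun t => logZII v ((S t + √3 * T t) / 2) (N t + P t) (O t))
      (4 / (1 + v / 2 * ((S t + √3 * T t) / 2)) * ((1 - v) * ((√3 * S t - T t) / 2) ^ 2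
        + (v * (1 - v) / (4 - v ^ 2) * v + 1 - v) * ((S t + √3 * T t) / 2 + v / 2) ^ 2)
        - 3 * v * (N t * (N t - P t)) / (1 + v / 2 * ((S t + √3 * T t) / 2))) t := by
  have hW : 0 < 1 + v / 2 * ((S t + √3 * T t) / 2) := by linarith [h.rot_pos t]
  have hA := (h.A_pos t).ne'
  have h4 : 4 - v ^ 2 ≠ 0 := by nlinarith [h.v_pos, h.v_lt]
  have hlA : HasDerivAt (fun t => Real.log (N t + P t))
      (2 - (2 * (1 - v) * O t + 2 * N t ^ 2) + 2 * S t + 2 * √3 * T t) t :=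
    ((h.dA t).log hA).congr_deriv (mul_div_cancel_right₀ _ hA)
  refine (((hlA.const_mul (2 * (v * (1 - v) / (4 - v ^ 2)))).add
    ((h.d_log_O hO).const_mul (1 - v * (1 - v) / (4 - v ^ 2)))).sub
    (((((h.d_rot t).const_mul (v / 2)).const_add 1).log hW.ne').const_mul 2)).congr_deriv ?_
  have hST : 2 * S t + 2 * √3 * T t = 4 * ((S t + √3 * T t) / 2) := by ring
  have hc : O t = 1 - ((S t + √3 * T t) / 2) ^ 2 - ((√3 * S t - T t) / 2) ^ 2 - N t ^ 2 := by
    linarith [h.constraint t, rot_sq_add (S t) (T t)]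
  rw [add_assoc (2 - _) (2 * S t), hST, hc]
  generalize (S t + √3 * T t) / 2 = s at *
  generalize (√3 * S t - T t) / 2 = r at *
  have hW' : 2 + v * s ≠ 0 := by linarith
  field_simp
  ring

theorem le_d_logZII (h : IsOrbit v S T P N O) (t : ℝ) :
    2 * (1 - v) * (((√3 * S t - T t) / 2) ^ 2 + ((S t + √3 * T t) / 2 + v / 2) ^ 2)
      - 6 * (N t * (N t - P t)) ≤
      4 / (1 + v / 2 * ((S t + √3 * T t) / 2)) * ((1 - v) * ((√3 * S t - T t) / 2) ^ 2
        + (v * (1 - v) / (4 - v ^ 2) * v + 1 - v) * ((S t + √3 * T t) / 2 + v / 2) ^ 2)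
        - 3 * v * (N t * (N t - P t)) / (1 + v / 2 * ((S t + √3 * T t) / 2)) := by
  have h1 := h.rot_pos t
  have h2 := h.rot_le t
  have hv := h.v_pos
  have hw : 0 < 1 - v := by linarith [h.v_lt]
  have h4 : 0 < 4 - v ^ 2 := by nlinarith [h.v_lt]
  have hNB : 0 < N t * (N t - P t) := mul_pos (h.N_pos t) (h.B_pos t)
  generalize 1 + v / 2 * ((S t + √3 * T t) / 2) = W at *
  have hW : 0 < W := by linarith
  have e1 : 2 ≤ 4 / W := by
    rw [le_div_iff₀ hW]; linarith
  have e2 : 3 * v * (N t * (N t - P t)) / W ≤ 6 * (N t * (N t - P t)) := by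
    rw [div_le_iff₀ hW]
    calc 3 * v * (N t * (N t - P t)) ≤ 3 * 1 * (N t * (N t - P t)) := by
          gcongr
          exact h.v_lt.le
      _ = 6 * (N t * (N t - P t)) * (1 / 2) := by ring
      _ ≤ _ := by gcongr
  have e3 : 0 ≤ v * (1 - v) / (4 - v ^ 2) * v := by positivity
  have e4 := sq_nonneg ((√3 * S t - T t) / 2)
  have e5 := sq_nonneg ((S t + √3 * T t) / 2 + v / 2)
  have e6 : (1 - v) * (((√3 * S t - T t) / 2) ^ 2 + ((S t + √3 * T t) / 2 + v / 2) ^ 2) ≤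
      (1 - v) * ((√3 * S t - T t) / 2) ^ 2
        + (v * (1 - v) / (4 - v ^ 2) * v + 1 - v) * ((S t + √3 * T t) / 2 + v / 2) ^ 2 := by
    nlinarith [mul_nonneg e3 e5]
  have e7 : 0 ≤ (1 - v) * (((√3 * S t - T t) / 2) ^ 2
      + ((S t + √3 * T t) / 2 + v / 2) ^ 2) := by positivity
  have e8 := mul_le_mul e1 e6 e7 (by positivity)
  linarith

/-- The derivatives of the two monotone functions do not vanish simultaneously. -/
theorem le_sum_deriv (h : IsOrbit v S T P N O) (t : ℝ) :
    3 / 4 * (1 - v) * v ^ 2 ≤ 2 * ((1 - v ^ 2) * T t ^ 2 + (S t + v) ^ 2)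
      + 2 * (1 - v) * (((√3 * S t - T t) / 2) ^ 2 + ((S t + √3 * T t) / 2 + v / 2) ^ 2) := by
  have s3 : √3 ^ 2 = (3 : ℝ) := Real.sq_sqrt (by norm_num)
  have hv := h.v_pos
  have hw : 0 < 1 - v := by linarith [h.v_lt]
  have e1 : ((√3 * S t - T t) / 2) ^ 2 + ((S t + √3 * T t) / 2 + v / 2) ^ 2
      = (S t + v / 4) ^ 2 + (T t + √3 * v / 4) ^ 2 := by
    linear_combination ((S t ^ 2 + T t ^ 2) / 4 - v ^ 2 / 16) * s3
  -- The zeros `(-v, 0)` and `(-v/4, -√3v/4)` of the two quadratic forms have squared distance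
  -- `3v²/4`. The sum of the squared distances to two points is at least half of that.
  have e2 : 3 / 8 * v ^ 2 ≤ (T t ^ 2 + (S t + v) ^ 2)
      + ((S t + v / 4) ^ 2 + (T t + √3 * v / 4) ^ 2) := by
    nlinarith [sq_nonneg (2 * S t + 5 * v / 4), sq_nonneg (2 * T t + √3 * v / 4)]
  have e3 : (1 - v) * (T t ^ 2 + (S t + v) ^ 2) ≤ (1 - v ^ 2) * T t ^ 2 + (S t + v) ^ 2 := by
    have h1 : 0 ≤ (v - v ^ 2) * T t ^ 2 := mul_nonneg (by nlinarith) (sq_nonneg _)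
    have h2 : 0 ≤ v * (S t + v) ^ 2 := by positivity
    linarith
  rw [e1]
  have e4 := mul_le_mul_of_nonneg_left e2 hw.le
  linarith

theorem exists_le_logZII (h : IsOrbit v S T P N O) {ω n : ℝ} (hω : 0 < ω)
    (hO : ∀ t ≤ 0, ω ≤ O t) (hn : 0 < n) (hN : ∀ t ≤ 0, n ≤ N t ^ 2) {c : ℝ} (hc : c ≤ 0)
    (hP : ∀ t ≤ c, 0 < P t) :
    ∃ m, ∀ t ≤ c, m ≤ logZII v ((S t + √3 * T t) / 2) (N t + P t) (O t) := by
  have hv := h.v_pos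
  have hw : 0 < 1 - v := by linarith [h.v_lt]
  have h4 : 0 < 4 - v ^ 2 := by nlinarith [h.v_lt]
  have hα : 0 ≤ v * (1 - v) / (4 - v ^ 2) := by positivity
  have hα1 : v * (1 - v) / (4 - v ^ 2) ≤ 1 := by
    rw [div_le_one h4]; nlinarith
  refine ⟨2 * (v * (1 - v) / (4 - v ^ 2)) * Real.log √n
    + (1 - v * (1 - v) / (4 - v ^ 2)) * Real.log ω - 2 * Real.log 2, fun t ht => ?_⟩
  have ht0 := ht.trans hc
  have h1 : Real.log √n ≤ Real.log (N t + P t) := by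
    apply Real.log_le_log (Real.sqrt_pos.2 hn)
    have := Real.sqrt_le_sqrt (hN t ht0)
    rw [Real.sqrt_sq (h.N_pos t).le] at this
    linarith [hP t ht]
  have h2 := Real.log_le_log hω (hO t ht0)
  have h3 := Real.log_le_log (by linarith [h.rot_pos t]) (h.rot_le t)
  unfold logZII
  have e1 := mul_le_mul_of_nonneg_left h1 (by positivity : 0 ≤ 2 * (v * (1 - v) / (4 - v ^ 2)))
  have e2 := mul_le_mul_of_nonneg_left h2 (by linarith : 0 ≤ 1 - v * (1 - v) / (4 - v ^ 2))
  linarith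

/-- `N₂ N₃` decays exponentially in the past along orbits that stay away from `Ω = 0` and from
`N₋ = 0`, provided that it tends to zero. -/
theorem exists_AB_le_exp (h : IsOrbit v S T P N O) {ω n : ℝ} (hω : 0 < ω)
    (hO : ∀ t ≤ 0, ω ≤ O t) (hn : 0 < n) (hN : ∀ t ≤ 0, n ≤ N t ^ 2) {c : ℝ} (hc : c ≤ 0)
    (hP : ∀ t ≤ c, 0 < P t)
    (hAB : Tendsto (fun t => (N t + P t) * (N t - P t)) atBot (𝓝 0)) :
    ∃ C k c', 0 < C ∧ 0 < k ∧ ∀ t ≤ c', N t * (N t - P t) ≤ C * Real.exp (k * t) := by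
  have hv := h.v_pos
  have hw : 0 < 1 - v := by linarith [h.v_lt]
  have hO0 : ∀ t, 0 < O t := h.O_pos_of_O_pos (hω.trans_le (hO 0 le_rfl))
  obtain ⟨m, hm⟩ := h.exists_le_logZII hω hO hn hN hc hP
  -- Half the lower bound of `le_sum_deriv`; the other half absorbs the defect `6NB`. So `logZ +
  -- logZII` decreases at least linearly backwards, and as `logZII` is bounded below, `logZ` and
  -- with it `log AB` do too.
  set κ := 3 / 8 * (1 - v) * v ^ 2 with hκ
  have hκpos : 0 < κ := by positivity
  have hNB : ∀ t ≤ c, N t * (N t - P t) ≤ (N t + P t) * (N t - P t) := fun t ht =>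
    mul_le_mul_of_nonneg_right (by linarith [hP t ht]) (h.B_pos t).le
  obtain ⟨c1, hc1⟩ := eventually_atBot.1 ((hAB.eventually_le_const
    (by positivity : 0 < κ / 6)).and (eventually_le_atBot c))
  set G : ℝ → ℝ := fun t => logZ v (S t) (P t) (N t) (O t)
    + logZII v ((S t + √3 * T t) / 2) (N t + P t) (O t) with hG
  have hmono : ∀ t ≤ c1, G t - κ * t ≤ G c1 - κ * c1 := by
    intro t ht
    refine mono_of_hasDerivAt (f := fun t => G t - κ * t) (fun s _ =>
      ((h.d_logZ (hO0 s)).add (h.d_logZII (hO0 s))).sub ((hasDerivAt_id s).const_mul κ))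
      (fun s hs => ?_) ht le_rfl
    have e1 := h.le_d_logZ s
    have e2 := h.le_d_logZII s
    have e3 := h.le_sum_deriv s
    have e4 := (hNB s (hc1 s hs).2).trans (hc1 s hs).1
    linarith
  set M := G c1 - κ * c1 - m - Real.log ω + 2 * (1 + v) * Real.log 2 with hM
  refine ⟨Real.exp (M / v), κ / v, c1, Real.exp_pos _, by positivity, fun t ht => ?_⟩
  have htc := (hc1 t ht).2
  refine (hNB t htc).trans ?_
  have hpos := mul_pos (h.A_pos t) (h.B_pos t)
  rw [← Real.exp_add, ← Real.log_le_iff_le_exp hpos]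
  have e1 := hmono t ht
  have e2 := hm t htc
  have e3 := Real.log_le_log hω (hO t (htc.trans hc))
  have hW := one_add_mul_pos hv h.v_lt (h.abs_S_lt t).le
  have e4 : Real.log (1 + v * S t) ≤ Real.log 2 := Real.log_le_log hW (by
    nlinarith [(_root_.abs_lt.1 (h.abs_S_lt t)).2, h.v_lt])
  have e5 := mul_le_mul_of_nonneg_left e4 (by positivity : 0 ≤ 2 * (1 + v))
  have e6 : G t = v * Real.log ((N t + P t) * (N t - P t)) + Real.log (O t)
      - 2 * (1 + v) * Real.log (1 + v * S t)
      + logZII v ((S t + √3 * T t) / 2) (N t + P t) (O t) := rfl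
  have e7 : M / v + κ / v * t = (M + κ * t) / v := by ring
  rw [e7, le_div_iff₀ hv]
  linarith

/-- The defect is integrable, so adding `(6C/k) exp(kt)` to `logZII` restores monotonicity and
forces the quadratic form in its derivative to zero. This fixes `S` and `T`. The equation for `(S +
√3T)/2` fixes `N²`, and `NB → 0` makes `P` follow `N`. -/
theorem tendsto_P2 (h : IsOrbit v S T P N O) {ω n : ℝ} (hω : 0 < ω)
    (hO : ∀ t ≤ 0, ω ≤ O t) (hn : 0 < n) (hN : ∀ t ≤ 0, n ≤ N t ^ 2) {c : ℝ} (hc : c ≤ 0)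
    (hP : ∀ t ≤ c, 0 < P t)
    (hAB : Tendsto (fun t => (N t + P t) * (N t - P t)) atBot (𝓝 0)) :
    Tendsto S atBot (𝓝 (-(v / 4))) ∧ Tendsto T atBot (𝓝 (-(√3 * v / 4))) ∧
      Tendsto P atBot (𝓝 (√(v * (1 - v)) / 2)) ∧ Tendsto N atBot (𝓝 (√(v * (1 - v)) / 2)) ∧
      Tendsto O atBot (𝓝 (1 - v / 4)) := by
  have hv := h.v_pos
  have hw : 0 < 1 - v := by linarith [h.v_lt]
  have s3 : √3 ^ 2 = (3 : ℝ) := Real.sq_sqrt (by norm_num)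
  have hO0 : ∀ t, 0 < O t := h.O_pos_of_O_pos (hω.trans_le (hO 0 le_rfl))
  obtain ⟨m, hm⟩ := h.exists_le_logZII hω hO hn hN hc hP
  obtain ⟨C, k, c', hC, hk, hNB⟩ := h.exists_AB_le_exp hω hO hn hN hc hP hAB
  have hexp : ∀ t, HasDerivAt (fun t => Real.exp (k * t)) (k * Real.exp (k * t)) t := fun t =>
    (((hasDerivAt_id t).const_mul k).exp).congr_deriv (by simp only [id]; ring)
  obtain ⟨g', K, hg', hK⟩ := h.exists_deriv_bound
    (φ := fun x => 2 * (1 - v) * (((√3 * x.1 - x.2.1) / 2) ^ 2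
      + ((x.1 + √3 * x.2.1) / 2 + v / 2) ^ 2)) (by fun_prop)
  have hg := tendsto_zero_of_le_deriv (c := min c c') (m := m)
    (fun t _ => (h.d_logZII (hO0 t)).add ((hexp t).const_mul (6 * C / k)))
    (fun t _ => hg' t) (fun t _ => by positivity) (fun t ht => by
      have e1 := h.le_d_logZII t
      have e2 := hNB t (ht.trans (min_le_right _ _))
      have e3 : 6 * C / k * (k * Real.exp (k * t)) = 6 * (C * Real.exp (k * t)) := by
        field_simp
      rw [e3]
      linarith) (fun t _ => hK t) (fun t ht => by
      have e1 := hm t (ht.trans (min_le_left _ _))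
      have e2 : 0 < 6 * C / k * Real.exp (k * t) := by positivity
      simp only [Pi.add_apply]
      linarith)
  have hg1 := (hg.const_mul (1 / (2 * (1 - v)))).congr (f₂ := fun t =>
    ((√3 * S t - T t) / 2) ^ 2 + ((S t + √3 * T t) / 2 + v / 2) ^ 2) (fun t => by field_simp)
  rw [mul_zero] at hg1
  have hsq := hg1.sqrt
  rw [Real.sqrt_zero] at hsq
  have hr : Tendsto (fun t => (√3 * S t - T t) / 2) atBot (𝓝 0) :=
    squeeze_zero_norm (fun t => Real.abs_le_sqrt (by
      linarith [sq_nonneg ((S t + √3 * T t) / 2 + v / 2)])) hsq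
  have hs : Tendsto (fun t => (S t + √3 * T t) / 2) atBot (𝓝 (-(v / 2))) := by
    have h1 : Tendsto (fun t => (S t + √3 * T t) / 2 + v / 2) atBot (𝓝 0) :=
      squeeze_zero_norm (fun t => Real.abs_le_sqrt (by
        linarith [sq_nonneg ((√3 * S t - T t) / 2)])) hsq
    simpa using h1.sub_const (v / 2)
  have hS : Tendsto S atBot (𝓝 (-(v / 4))) := by
    have h1 := (hs.add (hr.const_mul √3)).div_const 2
    have h2 : (-(v / 2) + √3 * 0) / 2 = -(v / 4) := by ring
    rw [h2] at h1
    exact h1.congr fun t => by linear_combination (S t / 4) * s3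
  have hT : Tendsto T atBot (𝓝 (-(√3 * v / 4))) := by
    have h1 := ((hs.const_mul √3).sub hr).div_const 2
    have h2 : (√3 * -(v / 2) - 0) / 2 = -(√3 * v / 4) := by ring
    rw [h2] at h1
    exact h1.congr fun t => by linear_combination (T t / 4) * s3
  obtain ⟨s', K1, hs', hK1⟩ := h.exists_deriv_bound
    (φ := fun x => -(2 * (1 - v) * x.2.2.2.2 + 2 * x.2.2.2.1 ^ 2) * ((x.1 + √3 * x.2.1) / 2)
      - x.2.2.2.1 ^ 2 - 3 * x.2.2.1 * x.2.2.2.1) (by fun_prop)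
  have hds := tendsto_deriv_zero (c := 0) (fun t _ => h.d_rot t) (fun t _ => hs' t)
    (fun t _ => hK1 t) hs
  have hNB0 : Tendsto (fun t => N t * (N t - P t)) atBot (𝓝 0) := by
    refine tendsto_of_tendsto_of_tendsto_of_le_of_le' (h := fun t => C * Real.exp (k * t))
      tendsto_const_nhds ?_ (Eventually.of_forall fun t => (mul_pos (h.N_pos t) (h.B_pos t)).le)
      (eventually_atBot.2 ⟨c', hNB⟩)
    simpa using (tendsto_exp_mul_atBot hk).const_mul C
  have hN2 : Tendsto (fun t => N t ^ 2) atBot (𝓝 (v * (1 - v) / 4)) := by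
    have h1 : Tendsto (fun t => (-(-(2 * (1 - v) * O t + 2 * N t ^ 2) * ((S t + √3 * T t) / 2)
        - N t ^ 2 - 3 * P t * N t) + 3 * (N t * (N t - P t))
        - 2 * (1 - v) * (1 - ((S t + √3 * T t) / 2) ^ 2 - ((√3 * S t - T t) / 2) ^ 2)
          * ((S t + √3 * T t) / 2)) / (4 + 2 * v * ((S t + √3 * T t) / 2))) atBot
        (𝓝 ((-0 + 3 * 0 - 2 * (1 - v) * (1 - (-(v / 2)) ^ 2 - 0 ^ 2) * (-(v / 2)))
          / (4 + 2 * v * (-(v / 2))))) :=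
      ((hds.neg.add (hNB0.const_mul 3)).sub
        (((((hs.pow 2).const_sub 1).sub (hr.pow 2)).const_mul _).mul hs)).div
        ((hs.const_mul _).const_add 4) (by nlinarith [h.v_lt])
    have h2 : (-0 + 3 * 0 - 2 * (1 - v) * (1 - (-(v / 2)) ^ 2 - 0 ^ 2) * (-(v / 2)))
          / (4 + 2 * v * (-(v / 2))) = v * (1 - v) / 4 := by
      rw [div_eq_iff (by nlinarith [h.v_lt])]; ring
    rw [h2] at h1
    refine h1.congr fun t => ?_
    have hc : O t = 1 - ((S t + √3 * T t) / 2) ^ 2 - ((√3 * S t - T t) / 2) ^ 2 - N t ^ 2 := by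
      linarith [h.constraint t, rot_sq_add (S t) (T t)]
    rw [div_eq_iff (by linarith [h.rot_pos t]), hc]
    ring
  have hsqrt : √(v * (1 - v) / 4) = √(v * (1 - v)) / 2 := by
    rw [Real.sqrt_div' _ (by norm_num), show (4 : ℝ) = 2 ^ 2 by norm_num,
      Real.sqrt_sq (by norm_num)]
  have hNl : Tendsto N atBot (𝓝 (√(v * (1 - v)) / 2)) := by
    rw [← hsqrt]
    exact hN2.sqrt.congr fun t => Real.sqrt_sq (h.N_pos t).le
  have hnpos : 0 < √(v * (1 - v)) / 2 := by
    have : 0 < √(v * (1 - v)) := Real.sqrt_pos.2 (by positivity)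
    positivity
  refine ⟨hS, hT, ?_, hNl, ?_⟩
  · have h1 := hNl.sub (hNB0.div hNl hnpos.ne')
    rw [zero_div, sub_zero] at h1
    refine h1.congr fun t => ?_
    have := (h.N_pos t).ne'
    simp only [Pi.div_apply]
    field_simp
    ring
  · have h1 := (((hS.pow 2).const_sub 1).sub (hT.pow 2)).sub hN2
    have h2 : 1 - (-(v / 4)) ^ 2 - (-(√3 * v / 4)) ^ 2 - v * (1 - v) / 4 = 1 - v / 4 := by
      linear_combination (-(v ^ 2 / 16)) * s3
    rw [h2] at h1
    exact h1.congr fun t => by linarith [h.constraint t]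

/-! ### The dichotomy in the past and the conclusion. -/

/-- Past asymptotics of an orbit that never enters the trapping region `2 Ω < (1 + Σ₊)²`. -/
theorem limits_of_not_trap (h : IsOrbit v S T P N O)
    (htrap : ∀ t ≤ 0, (1 + S t) ^ 2 / 2 ≤ O t) :
    (Tendsto S atBot (𝓝 0) ∧ Tendsto T atBot (𝓝 0) ∧ Tendsto P atBot (𝓝 0) ∧
      Tendsto N atBot (𝓝 0) ∧ Tendsto O atBot (𝓝 1)) ∨
    (Tendsto S atBot (𝓝 (-(v / 4))) ∧ Tendsto T atBot (𝓝 (-(√3 * v / 4))) ∧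
      Tendsto P atBot (𝓝 (√(v * (1 - v)) / 2)) ∧ Tendsto N atBot (𝓝 (√(v * (1 - v)) / 2)) ∧
      Tendsto O atBot (𝓝 (1 - v / 4))) ∨
    (Tendsto S atBot (𝓝 (-(v / 4))) ∧ Tendsto T atBot (𝓝 (√3 * v / 4)) ∧
      Tendsto P atBot (𝓝 (-(√(v * (1 - v)) / 2))) ∧ Tendsto N atBot (𝓝 (√(v * (1 - v)) / 2)) ∧
      Tendsto O atBot (𝓝 (1 - v / 4))) ∨
    (S 0 = -v ∧ T 0 = 0 ∧ P 0 = 0 ∧ N 0 = √(v * (1 - v)) ∧ O 0 = 1 - v) := by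
  have hv := h.v_pos
  have hw : 0 < 1 - v := by linarith [h.v_lt]
  set ε := (1 - v) ^ 2 / 300 with hε
  have hεpos : 0 < ε := by positivity
  have hp : ∀ t ≤ 0, ε ≤ 1 + S t := by
    intro t ht
    by_contra! hlt
    obtain ⟨s, hs, hsO⟩ := h.exists_trap_of_small hlt
    linarith [htrap s (hs.trans ht)]
  have hω : 0 < ε ^ 2 / 2 := by positivity
  have hO : ∀ t ≤ 0, ε ^ 2 / 2 ≤ O t := by
    intro t ht
    have := pow_le_pow_left₀ hεpos.le (hp t ht) 2
    linarith [htrap t ht]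
  have hO0 : ∀ t, 0 < O t := h.O_pos_of_O_pos (hω.trans_le (hO 0 le_rfl))
  by_cases hm : ∃ m, ∀ t ≤ 0, m ≤ logZ v (S t) (P t) (N t) (O t)
  · obtain ⟨m, hm⟩ := hm
    exact Or.inr (Or.inr (Or.inr (h.eq_P1_of_le_logZ hO0 hm 0)))
  push Not at hm
  have hAB : Tendsto (fun t => (N t + P t) * (N t - P t)) atBot (𝓝 0) := by
    rw [Metric.tendsto_nhds]
    intro δ hδ
    -- Since `O ≥ ε²/2` and `1 + vS ≤ 2`, a value of `logZ` below this threshold forces `AB < δ`.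
    -- Monotonicity keeps `logZ` below it at all earlier times.
    obtain ⟨c, hc0, hc⟩ := hm (v * Real.log δ + Real.log (ε ^ 2 / 2) - 2 * (1 + v) * Real.log 2)
    filter_upwards [eventually_le_atBot c] with t ht
    have hpos := mul_pos (h.A_pos t) (h.B_pos t)
    rw [Real.dist_eq, sub_zero, abs_of_pos hpos]
    have e1 := (h.logZ_mono hO0 ht).trans_lt hc
    have e3 := Real.log_le_log hω (hO t (ht.trans hc0))
    have hW := one_add_mul_pos hv h.v_lt (h.abs_S_lt t).le
    have e4 : Real.log (1 + v * S t) ≤ Real.log 2 := Real.log_le_log hW (by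
      nlinarith [(_root_.abs_lt.1 (h.abs_S_lt t)).2, h.v_lt])
    have e5 := mul_le_mul_of_nonneg_left e4 (by positivity : 0 ≤ 2 * (1 + v))
    unfold logZ at e1
    have e6 : v * Real.log ((N t + P t) * (N t - P t)) < v * Real.log δ := by linarith
    exact (Real.log_lt_log_iff hpos hδ).1 (lt_of_mul_lt_mul_left e6 hv.le)
  rcases h.tendsto_F_or hω hO with hF | ⟨n, hn, hN⟩
  · exact Or.inl hF
  right
  obtain ⟨c, hc⟩ := eventually_atBot.1 ((hAB.eventually_lt_const hn).and (eventually_le_atBot 0))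
  have hc0 := (hc c le_rfl).2
  -- Here `N² - P² < n ≤ N²`, so `P` has a constant sign in the past. The sign selects the
  -- equilibrium.
  have hPne : ∀ t ≤ c, P t ≠ 0 := by
    intro t ht h0
    have h1 := (hc t ht).1
    have h2 := hN t (hc t ht).2
    rw [h0] at h1
    linarith
  have hsign : ∀ s ≤ c, ∀ t ≤ c, P s < 0 → 0 < P t → False := by
    intro s hs t ht h1 h2
    obtain ⟨r, hr, hr0⟩ := isPreconnected_Iic.intermediate_value (a := s) (b := t)
      (s := Set.Iic c) hs ht h.continuous_P.continuousOn ⟨h1.le, h2.le⟩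
    exact hPne r hr hr0
  rcases lt_or_gt_of_ne (hPne c le_rfl) with hneg | hpos
  · right; left
    have hP : ∀ t ≤ c, 0 < (-P) t := fun t ht => by
      rcases lt_or_gt_of_ne (hPne t ht) with h1 | h1
      · simpa using h1
      · exact (hsign c le_rfl t ht hneg h1).elim
    obtain ⟨e1, e2, e3, e4, e5⟩ := h.reflect.tendsto_P2 hω hO hn hN hc0 hP
      (hAB.congr fun t => by simp only [Pi.neg_apply]; ring)
    exact ⟨e1, by simpa using e2.neg, by simpa using e3.neg, e4, e5⟩
  · left
    have hP : ∀ t ≤ c, 0 < P t := fun t ht => by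
      rcases lt_or_gt_of_ne (hPne t ht) with h1 | h1
      · exact (hsign t ht c le_rfl h1 hpos).elim
      · exact h1
    exact h.tendsto_P2 hω hO hn hN hc0 hP hAB

end IsOrbit
theorem IsGeneric.exists_trap {γ : ℝ} (hγ : γ ∈ Set.Ioo (2 / 3 : ℝ) 2) {x : State}
    (hx : IsGeneric γ x) {X : ℝ → State} (hX : IsSolution γ x X) :
    ∃ t, X t 4 < (1 + X t 0) ^ 2 / 2 := by
  obtain ⟨hmem, h1, h2, h3, hF⟩ := hx
  by_contra! htrap
  have hq : qStar γ * (2 - qStar γ) = 2 ^ 2 * (qStar γ / 2 * (1 - qStar γ / 2)) := by ring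
  have hsq : √(qStar γ * (2 - qStar γ)) = 2 * √(qStar γ / 2 * (1 - qStar γ / 2)) := by
    rw [hq, Real.sqrt_mul (by norm_num), Real.sqrt_sq (by norm_num)]
  rcases (hX.isOrbit hγ hmem).limits_of_not_trap (fun t _ => htrap t) with
    ⟨e0, e1, e2, e3, e4⟩ | ⟨e0, e1, e2, e3, e4⟩ | ⟨e0, e1, e2, e3, e4⟩ | ⟨e0, e1, e2, e3, e4⟩
  · refine hF ⟨hmem, X, hX, tendsto_pi_nhds.2 fun i => ?_⟩
    fin_cases i
    exacts [e0, e1, e2, e3, e4]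
  · refine h2 ⟨hmem, X, hX, tendsto_pi_nhds.2 fun i => ?_⟩
    fin_cases i
    · convert e0 using 2
      · rfl
      change -(qStar γ / 8) = _
      ring
    · convert e1 using 2
      · rfl
      change -(√3 * qStar γ / 8) = _
      ring
    · convert e2 using 2
      · rfl
      change √(qStar γ * (2 - qStar γ)) / 4 = _
      rw [hsq]
      ring
    · convert e3 using 2
      · rfl
      change √(qStar γ * (2 - qStar γ)) / 4 = _
      rw [hsq]
      ring
    · convert e4 using 2
      · rfl
      change 1 - qStar γ / 8 = _
      ring
  · refine h3 ⟨hmem, X, hX, tendsto_pi_nhds.2 fun i => ?_⟩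
    fin_cases i
    · convert e0 using 2
      · rfl
      change -(qStar γ / 8) = _
      ring
    · convert e1 using 2
      · rfl
      change √3 * qStar γ / 8 = _
      ring
    · convert e2 using 2
      · rfl
      change -(√(qStar γ * (2 - qStar γ)) / 4) = _
      rw [hsq]
      ring
    · convert e3 using 2
      · rfl
      change √(qStar γ * (2 - qStar γ)) / 4 = _
      rw [hsq]
      ring
    · convert e4 using 2
      · rfl
      change 1 - qStar γ / 8 = _
      ring
  · refine h1 ?_
    rw [hX.1] at e0 e1 e2 e3 e4
    ext i
    fin_cases i <;> simp only [pointP1, hsq]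
    · simpa using e0
    · simpa using e1
    · simpa using e2
    · simpa using e3
    · simpa using e4

end BianchiVI0

theorem mainTheorem5 (γ : ℝ) (hγ : γ ∈ Set.Ioo (2 / 3 : ℝ) 2)
    (x : BianchiVI0.State) (hx : BianchiVI0.IsGeneric γ x) :
    ∃ X : ℝ → BianchiVI0.State,
      BianchiVI0.IsSolution γ x X ∧
      (∀ Y : ℝ → BianchiVI0.State, BianchiVI0.IsSolution γ x Y → Y = X) ∧
      (∀ τ : ℝ, 0 < 2 - BianchiVI0.q γ (X τ)) ∧
      Tendsto (fun τ : ℝ => 2 - BianchiVI0.q γ (X τ)) atBot (𝓝 0) ∧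
      ∃ C η : ℝ, 0 < C ∧ 0 < η ∧
        ∀ τ : ℝ, 2 - BianchiVI0.q γ (X τ) ≤ C * Real.exp (2 * η * τ) := by
  obtain ⟨X, hX⟩ := BianchiVI0.exists_isSolution γ hx.1
  have h := hX.isOrbit hγ hx.1
  have hq : ∀ τ, 2 - BianchiVI0.q γ (X τ)
      = 2 * (1 - BianchiVI0.qStar γ / 2) * X τ 4 + 2 * X τ 3 ^ 2 := fun τ =>
    BianchiVI0.two_sub_q (hX.mem_phaseSpace hx.1 τ)
  have hpos : ∀ τ, 0 < 2 - BianchiVI0.q γ (X τ) := by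
    intro τ
    rw [hq]
    have h1 := h.O_nonneg τ
    have h2 := h.N_pos τ
    have h3 : 0 < 1 - BianchiVI0.qStar γ / 2 := by linarith [h.v_lt]
    positivity
  obtain ⟨c, hc⟩ := hx.exists_trap hγ hX
  obtain ⟨C, η, c', hC, hη, hdecay⟩ := h.exists_exp_bound_of_trap hc
  have hle : ∀ τ ≤ c', 2 - BianchiVI0.q γ (X τ) ≤ C * Real.exp (2 * η * τ) := fun τ hτ => by
    rw [hq]
    exact hdecay τ hτ
  -- The added constant extends the estimate to `τ ≥ c'`, where `2 - q ≤ 4` suffices.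
  refine ⟨X, hX, fun Y hY => hX.unique hx.1 hY, hpos, ?_, C + 4 * Real.exp (-(2 * η * c')), η,
    by positivity, hη, fun τ => ?_⟩
  · refine tendsto_of_tendsto_of_tendsto_of_le_of_le' (h := fun τ => C * Real.exp (2 * η * τ))
      tendsto_const_nhds ?_ (Eventually.of_forall fun τ => (hpos τ).le)
      (eventually_atBot.2 ⟨c', hle⟩)
    simpa using (BianchiVI0.tendsto_exp_mul_atBot (by positivity : 0 < 2 * η)).const_mul C
  · rw [add_mul, mul_assoc 4, ← BianchiVI0.exp_mul_sub]
    rcases le_total τ c' with hτ | hτ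
    · have := hle τ hτ
      have h2 := Real.exp_pos (2 * η * (τ - c'))
      linarith
    · have h1 : 1 ≤ Real.exp (2 * η * (τ - c')) :=
        Real.one_le_exp (mul_nonneg (by positivity) (by linarith))
      have h2 : 0 < C * Real.exp (2 * η * τ) := by positivity
      have h3 : 2 - BianchiVI0.q γ (X τ) ≤ 4 := by
        rw [hq]
        have h4 := h.O_nonneg τ
        have h5 := h.O_le_one τ
        have h6 := h.N_le_one τ
        have h7 := h.N_pos τ
        have h8 := h.v_pos
        nlinarith
      linarith
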